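/- Let $RAN_0$ be a triangle embedded in the plane, which has one bounded face. For $t\ge 0$, let $RAN_{t+1}$ be obtained from $RAN_t$ by choosing, given the past, a bounded face of $RAN_t$ uniformly at random, adding a new vertex inside this face and joining it to the three vertices of the face (so that the face is replaced by three new bounded faces). The random plane triangulation $RAN_t$, which has $t+3$ vertices, is called a random Apollonian network. Let $\mathcal L_t$ be the number of vertices in a longest (simple) path in $RAN_t$. Then there is a fixed real number $\delta<1$ such that almost surely $\mathcal L_t<t^{\delta}$ for all sufficiently large $t$. In particular, $\mathbb P(\mathcal L_t\le t^{\delta})\to 1$ as $t\to\infty$, as conjectured by Cooper and Frieze. -/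

import Mathlib

open MeasureTheory Filter Topology

/-- The combinatorial data of a plane graph obtained from an embedded triangle by repeatedly
subdividing bounded triangular faces: the vertices are `0, …, order - 1`, numbered in the order in
which they are added, `edges` is the set of edges, and `faces` is the set of bounded faces, each
given by the set of its three corners. -/
@[ext]
structure Apollonian where
  order : ℕ
  edges : Finset (Sym2 ℕ)
  faces : Finset (Finset ℕ)

namespace Apollonian

/-- A triangle embedded in the plane: three vertices, three edges and one bounded face. -/
def triangle : Apollonian where
  order := 3
  edges := {s(0, 1), s(0, 2), s(1, 2)}
  faces := {{0, 1, 2}}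

/-- Subdivision of the face `F`: a new vertex is put inside `F` and joined to the corners of `F`.
The face `F` disappears; for each corner `x` of `F` there is a new face, whose corners are the new
vertex and the corners of `F` other than `x`. -/
def subdivide (T : Apollonian) (F : Finset ℕ) : Apollonian where
  order := T.order + 1
  edges := T.edges ∪ F.image (fun x => s(x, T.order))
  faces := T.faces.erase F ∪ F.image (fun x => insert T.order (F.erase x))

/-- The underlying simple graph, on the vertices `0, …, order - 1`. -/
def graph (T : Apollonian) : SimpleGraph (Fin T.order) :=
  (SimpleGraph.fromEdgeSet (T.edges : Set (Sym2 ℕ))).comap Fin.val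

/-- There are countably many states; every set of states is an event. -/
instance : MeasurableSpace Apollonian := ⊤

end Apollonian

/-- The numbers of vertices of the (simple) paths in `G`. -/
def pathOrders {V : Type*} (G : SimpleGraph V) : Set ℕ :=
  {n | ∃ (u v : V) (p : G.Walk u v), p.IsPath ∧ p.support.length = n}

/-- The number of vertices in a longest (simple) path of a finite graph `G`. -/
noncomputable def longestPathOrder {V : Type*} [Finite V] (G : SimpleGraph V) : ℕ :=
  sSup (pathOrders G)

/-- In a nonempty finite graph the maximum in the definition of `longestPathOrder` is attained. -/
theorem isGreatest_longestPathOrder {V : Type*} [Finite V] [Nonempty V] (G : SimpleGraph V) :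
    IsGreatest (pathOrders G) (longestPathOrder G) := by
  have hb : BddAbove (pathOrders G) := by
    have := Fintype.ofFinite V
    refine ⟨Fintype.card V, ?_⟩
    rintro n ⟨u, v, p, hp, rfl⟩
    exact hp.support_nodup.length_le_card
  have hne : (pathOrders G).Nonempty :=
    ⟨_, Classical.arbitrary V, _, SimpleGraph.Walk.nil, SimpleGraph.Walk.IsPath.nil, rfl⟩
  exact ⟨Nat.sSup_mem hne hb, fun n hn => le_csSup hb hn⟩

/-- `R 0, R 1, R 2, …` is the random Apollonian network process on the probability space `(Ω, μ)`:
it starts with a triangle and, conditionally on the whole history `R 0 = s 0, …, R t = s t`, the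
face that is subdivided in the next step is uniformly distributed over the bounded faces
of `s t`. -/
structure IsRandomApollonianNetwork {Ω : Type*} [MeasurableSpace Ω] (μ : Measure Ω)
    (R : ℕ → Ω → Apollonian) : Prop where
  measurable : ∀ t, Measurable (R t)
  init : ∀ᵐ ω ∂μ, R 0 ω = Apollonian.triangle
  step : ∀ (t : ℕ) (s : ℕ → Apollonian), ∀ F ∈ (s t).faces,
    μ {ω | (∀ i ≤ t, R i ω = s i) ∧ R (t + 1) ω = (s t).subdivide F} =
      μ {ω | ∀ i ≤ t, R i ω = s i} / ((s t).faces.card : ENNReal)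

/-! The subdivisions of the outer triangle form a random ternary tree: internal nodes are the added
vertices, leaves are the bounded faces, and each step turns a uniformly chosen leaf into an internal
node.

Geometry. Subdivide a triangle and then each of its three parts. The nine resulting triangles are
separated from each other by at most seven vertices: three corners, the centre and the three centres
of the parts. A path changes region only at these vertices, so it meets the interiors of at most
eight of the nine (`exists_disjoint_verts`). Applied at every node, this bounds the number of
vertices on a path by a function `avoidBound` of the tree alone, which drops one grandchild subtree
at each node (`visits_lt_avoidBound`, `Represents.longestPathOrder_le`).

Moments. By induction on `n`, the moment of `avoidBound` of order `r + 4` is `O(n ^ (r + 1))`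
(`exists_mass_avoidBound_pow_le`). Hölder's inequality with weights equal to numbers of leaves
bounds the moment for a node by a constant times `β * L ^ (r + 1)`, where `L` counts the leaves
outside the dropped grandchild. The constant does not depend on `r`. A fixed grandchild contains a
proportion at least `1 / K ^ 2` of the tree except with small probability
(`mass_firstSize_mul_lt_le`), so for large `K` and then large `r` the mean of `(L / (2 * n + 1)) ^
(r + 1)` beats this constant.

Conclusion. Expectations over the network are bounded by means over trees
(`lintegral_le_mass_div_totalMass`). With `δ = (r + 3) / (r + 4)`, Markov's inequality gives a
failure probability `O(t ^ (-2))`, and Borel–Cantelli applies. -/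

/-! ### Ternary trees grown at random leaves. -/

/-- Ternary trees, recording the nested subdivisions of a triangle. -/
inductive TernTree
  | leaf : TernTree
  | node (a b c : TernTree) : TernTree

namespace TernTree

/-- The number of internal nodes. -/
def size : TernTree → ℕ
  | leaf => 0
  | node a b c => a.size + b.size + c.size + 1

/-- The trees obtained by turning one leaf into an internal node, one for each leaf. -/
def grow : TernTree → List TernTree
  | leaf => [node leaf leaf leaf]
  | node a b c => (a.grow.map fun a' => node a' b c) ++ (b.grow.map fun b' => node a b' c) ++
      c.grow.map fun c' => node a b c'

theorem length_grow (T : TernTree) : T.grow.length = 2 * T.size + 1 := by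
  induction T with
  | leaf => rfl
  | node a b c ha hb hc => simp [grow, size, ha, hb, hc]; ring

theorem size_of_mem_grow {T T' : TernTree} (h : T' ∈ T.grow) : T'.size = T.size + 1 := by
  induction T generalizing T' with
  | leaf => simp [grow] at h; subst h; rfl
  | node a b c ha hb hc =>
    simp only [grow, List.mem_append, List.mem_map] at h
    rcases h with (⟨x, hx, rfl⟩ | ⟨x, hx, rfl⟩) | ⟨x, hx, rfl⟩
    · simp only [size, ha hx]; ring
    · simp only [size, hb hx]; ring
    · simp only [size, hc hx]; ring

/-- The sum of a function over the trees grown from a given tree. -/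
def growSum : (TernTree → ℝ) →ₗ[ℝ] (TernTree → ℝ) where
  toFun g T := (T.grow.map g).sum
  map_add' f g := by
    funext T
    exact List.sum_map_add
  map_smul' c g := by
    funext T
    exact List.sum_map_mul_left _ _ _

theorem growSum_apply (g : TernTree → ℝ) (T : TernTree) : growSum g T = (T.grow.map g).sum := rfl

theorem growSum_leaf (g : TernTree → ℝ) : growSum g leaf = g (node leaf leaf leaf) := by
  simp [growSum_apply, grow]

theorem growSum_node (g : TernTree → ℝ) (a b c : TernTree) :
    growSum g (node a b c) = growSum (fun a' => g (node a' b c)) a +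
      growSum (fun b' => g (node a b' c)) b + growSum (fun c' => g (node a b c')) c := by
  simp [growSum_apply, grow, Function.comp_def, add_assoc]

theorem growSum_comm (Λ : (TernTree → ℝ) →ₗ[ℝ] ℝ) (G : TernTree → TernTree → ℝ) (A : TernTree) :
    growSum (fun A' => Λ (G A')) A = Λ (fun B => growSum (fun A' => G A' B) A) := by
  simp only [growSum_apply]
  induction A.grow with
  | nil => exact (map_zero Λ).symm
  | cons x l ih =>
    simp only [List.map_cons, List.sum_cons, ih]
    exact (map_add Λ _ _).symm

/-- `n!⁻¹` times the sum of a function over all ways to grow a tree from a leaf in `n` steps. -/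
noncomputable def mass : ℕ → (TernTree → ℝ) →ₗ[ℝ] ℝ
  | 0 => LinearMap.proj leaf
  | n + 1 => ((n : ℝ) + 1)⁻¹ • (mass n).comp growSum

theorem mass_zero (g : TernTree → ℝ) : mass 0 g = g leaf := rfl

theorem mass_succ (n : ℕ) (g : TernTree → ℝ) :
    ((n : ℝ) + 1) * mass (n + 1) g = mass n (growSum g) := by
  have : (n : ℝ) + 1 ≠ 0 := by positivity
  simp [mass, this]

theorem mass_mono {n : ℕ} {f g : TernTree → ℝ} (h : ∀ T : TernTree, T.size = n → f T ≤ g T) :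
    mass n f ≤ mass n g := by
  induction n generalizing f g with
  | zero => exact h _ rfl
  | succ n ih =>
    have h1 : mass n (growSum f) ≤ mass n (growSum g) := by
      apply ih
      intro T hT
      apply List.sum_le_sum
      intro T' hT'
      exact h _ (by rw [size_of_mem_grow hT', hT])
    rw [← mass_succ, ← mass_succ] at h1
    exact le_of_mul_le_mul_left h1 (by positivity)

theorem mass_congr {n : ℕ} {f g : TernTree → ℝ} (h : ∀ T : TernTree, T.size = n → f T = g T) :
    mass n f = mass n g :=
  le_antisymm (mass_mono fun T hT => (h T hT).le) (mass_mono fun T hT => (h T hT).ge)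

/-- Fubini for a mass and any linear functional: `mass n` is a finite combination of evaluations. -/
theorem mass_comm (n : ℕ) (Λ : (TernTree → ℝ) →ₗ[ℝ] ℝ) (G : TernTree → TernTree → ℝ) :
    mass n (fun A => Λ (G A)) = Λ (fun B => mass n (fun A => G A B)) := by
  induction n generalizing G with
  | zero => rfl
  | succ n ih =>
    have h1 : growSum (fun A => Λ (G A)) =
        fun A => Λ (fun B => growSum (fun A' => G A' B) A) := by
      funext A; exact growSum_comm Λ G A
    have h2 := ih (fun A B => growSum (fun A' => G A' B) A)
    have h3 : (fun B => mass n (fun A => growSum (fun A' => G A' B) A)) =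
        ((n : ℝ) + 1) • fun B => mass (n + 1) (fun A => G A B) := by
      funext B
      simpa using (mass_succ n (fun A => G A B)).symm
    have h4 := mass_succ n (fun A => Λ (G A))
    rw [h1, h2, h3, map_smul, smul_eq_mul] at h4
    exact mul_left_cancel₀ (by positivity) h4

/-- The total mass of the trees with `n` internal nodes. -/
noncomputable def totalMass (n : ℕ) : ℝ := mass n fun _ => 1

theorem mass_const_mul (n : ℕ) (c : ℝ) (g : TernTree → ℝ) :
    mass n (fun T => c * g T) = c * mass n g := (mass n).map_smul c g

theorem mass_mul_const (n : ℕ) (c : ℝ) (g : TernTree → ℝ) :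
    mass n (fun T => g T * c) = mass n g * c := by
  simp only [mul_comm _ c, mass_const_mul]

theorem mass_add (n : ℕ) (f g : TernTree → ℝ) :
    mass n (fun T => f T + g T) = mass n f + mass n g := (mass n).map_add f g

theorem mass_const (n : ℕ) (c : ℝ) : mass n (fun _ => c) = c * totalMass n := by
  rw [totalMass, ← mass_const_mul]; simp only [mul_one]

theorem totalMass_zero : totalMass 0 = 1 := rfl

/-- A tree with `n` internal nodes has `2 * n + 1` leaves at which to grow. Hence `totalMass n` is
the central binomial coefficient of `2 * n` divided by `2 ^ n`. -/
theorem totalMass_succ (n : ℕ) :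
    ((n : ℝ) + 1) * totalMass (n + 1) = (2 * n + 1) * totalMass n := by
  rw [totalMass, mass_succ, ← mass_const]
  apply mass_congr
  intro T hT
  simp [growSum_apply, length_grow, hT]

theorem totalMass_pos (n : ℕ) : 0 < totalMass n := by
  induction n with
  | zero => simp [totalMass_zero]
  | succ n ih =>
    have h := totalMass_succ n
    have : 0 < ((n : ℝ) + 1) * totalMass (n + 1) := by rw [h]; positivity
    exact pos_of_mul_pos_right this (by positivity)

/-! ### Splitting a tree at its root. -/

/-- The triples of natural numbers with sum `n`. -/
def triples (n : ℕ) : Finset (ℕ × ℕ × ℕ) :=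
  (Finset.range (n + 1) ×ˢ Finset.range (n + 1) ×ˢ Finset.range (n + 1)).filter
    fun x => x.1 + x.2.1 + x.2.2 = n

theorem mem_triples {n : ℕ} {x : ℕ × ℕ × ℕ} : x ∈ triples n ↔ x.1 + x.2.1 + x.2.2 = n := by
  simp only [triples, Finset.mem_filter, Finset.mem_product, Finset.mem_range]
  omega

/-- The mass of a function of three trees with `n` internal nodes in total. -/
noncomputable def mass₃ (n : ℕ) (G : TernTree → TernTree → TernTree → ℝ) : ℝ :=
  ∑ x ∈ triples n, mass x.1 fun A => mass x.2.1 fun B => mass x.2.2 fun C => G A B C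

theorem mass₃_mono {n : ℕ} {F G : TernTree → TernTree → TernTree → ℝ}
    (h : ∀ A B C : TernTree, A.size + B.size + C.size = n → F A B C ≤ G A B C) :
    mass₃ n F ≤ mass₃ n G := by
  refine Finset.sum_le_sum fun x hx => ?_
  rw [mem_triples] at hx
  exact mass_mono fun A hA => mass_mono fun B hB => mass_mono fun C hC =>
    h A B C (by omega)

theorem mass₃_add (n : ℕ) (F G : TernTree → TernTree → TernTree → ℝ) :
    mass₃ n (fun A B C => F A B C + G A B C) = mass₃ n F + mass₃ n G := by
  simp only [mass₃, mass_add, Finset.sum_add_distrib]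

theorem mass₃_const_mul (n : ℕ) (c : ℝ) (G : TernTree → TernTree → TernTree → ℝ) :
    mass₃ n (fun A B C => c * G A B C) = c * mass₃ n G := by
  simp only [mass₃, mass_const_mul, Finset.mul_sum]

theorem mass₃_swap₁₂ (n : ℕ) (G : TernTree → TernTree → TernTree → ℝ) :
    mass₃ n (fun A B C => G B A C) = mass₃ n G := by
  refine Finset.sum_nbij' (fun x => (x.2.1, x.1, x.2.2)) (fun x => (x.2.1, x.1, x.2.2))
    ?_ ?_ ?_ ?_ ?_
  · intro x hx; simp only [mem_triples] at *; omega
  · intro x hx; simp only [mem_triples] at *; omega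
  · intro x _; rfl
  · intro x _; rfl
  · intro x _
    exact mass_comm x.1 (mass x.2.1) fun A B => mass x.2.2 fun C => G B A C

theorem mass₃_swap₂₃ (n : ℕ) (G : TernTree → TernTree → TernTree → ℝ) :
    mass₃ n (fun A B C => G A C B) = mass₃ n G := by
  refine Finset.sum_nbij' (fun x => (x.1, x.2.2, x.2.1)) (fun x => (x.1, x.2.2, x.2.1))
    ?_ ?_ ?_ ?_ ?_
  · intro x hx; simp only [mem_triples] at *; omega
  · intro x hx; simp only [mem_triples] at *; omega
  · intro x _; rfl
  · intro x _; rfl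
  · intro x _
    exact mass_congr fun A _ => mass_comm x.2.1 (mass x.2.2) fun B C => G A C B

/-- Growing the first tree shifts the first index by one, and the normalisation in `mass` turns this
into the weight `x.1`. The shifted sum misses only the terms with `x.1 = 0`, whose weight vanishes.
-/
theorem mass₃_growSum_first (n : ℕ) (G : TernTree → TernTree → TernTree → ℝ) :
    mass₃ n (fun A B C => growSum (fun A' => G A' B C) A) =
      ∑ x ∈ triples (n + 1), (x.1 : ℝ) *
        mass x.1 fun A => mass x.2.1 fun B => mass x.2.2 fun C => G A B C := by
  have key : ∀ x ∈ triples n, (mass x.1 fun A => mass x.2.1 fun B => mass x.2.2 fun C =>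
      growSum (fun A' => G A' B C) A) = ((x.1 : ℝ) + 1) *
        mass (x.1 + 1) fun A => mass x.2.1 fun B => mass x.2.2 fun C => G A B C := by
    intro x _
    rw [mass_succ]
    refine mass_congr fun A _ => ?_
    rw [growSum_comm]
    refine mass_congr fun B _ => ?_
    rw [growSum_comm]
  rw [mass₃, Finset.sum_congr rfl key]
  have hf := Finset.sum_filter_of_ne (s := triples (n + 1)) (p := fun x => x.1 ≠ 0)
    (f := fun x => (x.1 : ℝ) *
      mass x.1 fun A => mass x.2.1 fun B => mass x.2.2 fun C => G A B C)
    (fun x _ hx h0 => hx (by simp [h0]))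
  rw [← hf]
  refine Finset.sum_nbij' (fun x => (x.1 + 1, x.2.1, x.2.2)) (fun x => (x.1 - 1, x.2.1, x.2.2))
    ?_ ?_ ?_ ?_ ?_
  · intro x hx; simp only [mem_triples, Finset.mem_filter] at *; omega
  · intro x hx; simp only [mem_triples, Finset.mem_filter] at *; omega
  · intro x _; rfl
  · intro x hx
    have := (Finset.mem_filter.1 hx).2
    ext <;> simp
    omega
  · intro x _
    push_cast
    rfl

/-- A Leibniz rule: growth in the three trees contributes the weights `x.1`, `x.2.1`, `x.2.2`, whose
sum is `n + 1`. So `mass₃` obeys the same recursion as the mass of trees with a root, which is why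
the subtrees are independent given their sizes. -/
theorem mass₃_succ (n : ℕ) (G : TernTree → TernTree → TernTree → ℝ) :
    ((n : ℝ) + 1) * mass₃ (n + 1) G = mass₃ n fun A B C =>
      growSum (fun A' => G A' B C) A + growSum (fun B' => G A B' C) B +
        growSum (fun C' => G A B C') C := by
  have h2 : mass₃ n (fun A B C => growSum (fun B' => G A B' C) B) =
      ∑ x ∈ triples (n + 1), (x.2.1 : ℝ) *
        mass x.1 fun A => mass x.2.1 fun B => mass x.2.2 fun C => G A B C := by
    rw [← mass₃_swap₁₂, mass₃_growSum_first n fun A B C => G B A C]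
    refine Finset.sum_nbij' (fun x => (x.2.1, x.1, x.2.2)) (fun x => (x.2.1, x.1, x.2.2))
      ?_ ?_ ?_ ?_ ?_
    · intro x hx; simp only [mem_triples] at *; omega
    · intro x hx; simp only [mem_triples] at *; omega
    · intro x _; rfl
    · intro x _; rfl
    · intro x _
      rw [mass_comm x.1 (mass x.2.1) fun A B => mass x.2.2 fun C => G B A C]
  have h3 : mass₃ n (fun A B C => growSum (fun C' => G A B C') C) =
      ∑ x ∈ triples (n + 1), (x.2.2 : ℝ) *
        mass x.1 fun A => mass x.2.1 fun B => mass x.2.2 fun C => G A B C := by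
    rw [← mass₃_swap₁₂, ← mass₃_swap₂₃, ← mass₃_swap₁₂,
      mass₃_growSum_first n fun A B C => G C B A]
    refine Finset.sum_nbij' (fun x => (x.2.2, x.2.1, x.1)) (fun x => (x.2.2, x.2.1, x.1))
      ?_ ?_ ?_ ?_ ?_
    · intro x hx; simp only [mem_triples] at *; omega
    · intro x hx; simp only [mem_triples] at *; omega
    · intro x _; rfl
    · intro x _; rfl
    · intro x _
      congr 1
      rw [mass_congr fun A _ => mass_comm x.2.1 (mass x.2.2) fun B C => G C B A,
        mass_comm x.1 (mass x.2.2) fun A C => mass x.2.1 fun B => G C B A]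
      exact mass_congr fun C _ => mass_comm x.1 (mass x.2.1) fun A B => G C B A
  rw [mass₃_add, mass₃_add, mass₃_growSum_first, h2, h3, ← Finset.sum_add_distrib,
    ← Finset.sum_add_distrib, mass₃, Finset.mul_sum]
  refine Finset.sum_congr rfl fun x hx => ?_
  rw [mem_triples] at hx
  have : (x.1 : ℝ) + x.2.1 + x.2.2 = n + 1 := by exact_mod_cast hx
  rw [← this]
  ring

/-- The mass of trees decomposes according to the three subtrees of the root. -/
theorem mass_succ_eq_mass₃ (n : ℕ) (g : TernTree → ℝ) :
    ((n : ℝ) + 1) * mass (n + 1) g = mass₃ n fun A B C => g (node A B C) := by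
  induction n generalizing g with
  | zero =>
    have : triples 0 = {(0, 0, 0)} := by
      ext ⟨a, b, c⟩
      simp only [mem_triples, Finset.mem_singleton, Prod.mk.injEq]
      omega
    rw [mass_succ, mass_zero, growSum_leaf, mass₃, this, Finset.sum_singleton]
    rfl
  | succ n ih =>
    have h1 := ih (growSum g)
    simp only [growSum_node] at h1
    rw [← mass₃_succ n fun A B C => g (node A B C), ← mass_succ] at h1
    exact mul_left_cancel₀ (by positivity) h1

end TernTree

/-! ### Hölder inequalities weighted by numbers of leaves. -/

/-- A weighted power mean inequality: Hölder's inequality for three functions, one of them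
constant. -/
theorem sum_pow_le_card_pow_mul_sum_div {ι : Type*} (s : Finset ι) (m l : ι → ℝ)
    (hm : ∀ i ∈ s, 0 ≤ m i) (hl : ∀ i ∈ s, 0 < l i) (r : ℕ) :
    (∑ i ∈ s, m i) ^ (r + 4) ≤
      (s.card : ℝ) ^ 3 * (∑ i ∈ s, l i) ^ r * ∑ i ∈ s, m i ^ (r + 4) / l i ^ r := by
  rcases s.eq_empty_or_nonempty with rfl | hs
  · simp
  have hcard : (0 : ℝ) < s.card := by exact_mod_cast hs.card_pos
  -- The weights `w = l ^ θ` are chosen so that `w ^ (r + 3) = l ^ r`. Concavity of `x ^ θ` then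
  -- gives the bound for `W`, leaving the factor `s.card ^ (r + 3 - r)`.
  set θ : ℝ := r / (r + 3) with hθ
  have hθ0 : 0 ≤ θ := by positivity
  have hθ1 : θ ≤ 1 := by rw [hθ, div_le_one (by positivity)]; linarith
  have hθr : θ * (r + 3 : ℕ) = r := by rw [hθ]; push_cast; field_simp
  set w : ι → ℝ := fun i => l i ^ θ with hw
  have hwpos : ∀ i ∈ s, 0 < w i := fun i hi => Real.rpow_pos_of_pos (hl i hi) _
  have hwr : ∀ i ∈ s, w i ^ (r + 3) = l i ^ r := by
    intro i hi
    rw [hw]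
    simp only
    rw [← Real.rpow_natCast, ← Real.rpow_mul (hl i hi).le, hθr, Real.rpow_natCast]
  have hS : 0 < ∑ i ∈ s, l i := Finset.sum_pos hl hs
  set W := ∑ i ∈ s, w i with hWdef
  have hW : 0 < W := Finset.sum_pos hwpos hs
  have hWle : W ^ (r + 3) ≤ (s.card : ℝ) ^ 3 * (∑ i ∈ s, l i) ^ r := by
    have h1 := (Real.concaveOn_rpow hθ0 hθ1).le_map_sum (t := s) (w := fun _ => (s.card : ℝ)⁻¹)
      (p := l) (fun _ _ => by positivity) (by simp [hcard.ne'])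
      (fun i hi => (hl i hi).le)
    simp only [smul_eq_mul, ← Finset.mul_sum] at h1
    change (s.card : ℝ)⁻¹ * W ≤ _ at h1
    have h2 := pow_le_pow_left₀ (by positivity) h1 (r + 3)
    rw [← Real.rpow_natCast (((s.card : ℝ)⁻¹ * ∑ i ∈ s, l i) ^ θ),
      ← Real.rpow_mul (by positivity), hθr, Real.rpow_natCast, mul_pow, mul_pow, inv_pow,
      inv_pow] at h2
    rw [inv_mul_le_iff₀ (by positivity)] at h2
    refine h2.trans_eq ?_
    rw [pow_add]
    field_simp
  -- Jensen's inequality for the power `r + 4` at the points `m i / w i` with probability weights `w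
  -- i / W`.
  have h1 := Real.pow_arith_mean_le_arith_mean_pow s (fun i => w i / W) (fun i => m i / w i)
    (fun i hi => div_nonneg (hwpos i hi).le hW.le) (by rw [← Finset.sum_div]; exact div_self hW.ne')
    (fun i hi => div_nonneg (hm i hi) (hwpos i hi).le) (r + 4)
  have h2 : ∑ i ∈ s, w i / W * (m i / w i) = (∑ i ∈ s, m i) / W := by
    rw [Finset.sum_div]
    refine Finset.sum_congr rfl fun i hi => ?_
    have := (hwpos i hi).ne'
    field_simp
  have h3 : ∑ i ∈ s, w i / W * (m i / w i) ^ (r + 4) =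
      (∑ i ∈ s, m i ^ (r + 4) / l i ^ r) / W := by
    rw [Finset.sum_div]
    refine Finset.sum_congr rfl fun i hi => ?_
    have := (hwpos i hi).ne'
    rw [← hwr i hi, div_pow, pow_succ (w i) (r + 3)]
    field_simp
  rw [h2, h3, div_pow, div_le_div_iff₀ (by positivity) hW, pow_succ W (r + 3), ← mul_assoc] at h1
  refine (le_of_mul_le_mul_right h1 hW).trans ?_
  rw [mul_comm]
  exact mul_le_mul_of_nonneg_right hWle
    (Finset.sum_nonneg fun i hi => div_nonneg (pow_nonneg (hm i hi) _) (pow_nonneg (hl i hi).le _))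

theorem add_pow_le_mul_div_add_div {m₁ m₂ l₁ l₂ : ℝ} (hm₁ : 0 ≤ m₁) (hm₂ : 0 ≤ m₂)
    (hl₁ : 0 < l₁) (hl₂ : 0 < l₂) (r : ℕ) :
    (m₁ + m₂) ^ (r + 4) ≤
      8 * (l₁ + l₂) ^ r * (m₁ ^ (r + 4) / l₁ ^ r + m₂ ^ (r + 4) / l₂ ^ r) := by
  have h := sum_pow_le_card_pow_mul_sum_div Finset.univ ![m₁, m₂] ![l₁, l₂]
    (by simp [Fin.forall_fin_succ, *]) (by simp [Fin.forall_fin_succ, *]) r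
  simp only [Fin.sum_univ_two] at h
  norm_num at h
  exact h

theorem add_add_pow_le_mul_div_add_div {m₁ m₂ m₃ l₁ l₂ l₃ : ℝ} (hm₁ : 0 ≤ m₁) (hm₂ : 0 ≤ m₂)
    (hm₃ : 0 ≤ m₃) (hl₁ : 0 < l₁) (hl₂ : 0 < l₂) (hl₃ : 0 < l₃) (r : ℕ) :
    (m₁ + m₂ + m₃) ^ (r + 4) ≤ 27 * (l₁ + l₂ + l₃) ^ r *
      (m₁ ^ (r + 4) / l₁ ^ r + m₂ ^ (r + 4) / l₂ ^ r + m₃ ^ (r + 4) / l₃ ^ r) := by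
  have h := sum_pow_le_card_pow_mul_sum_div Finset.univ ![m₁, m₂, m₃] ![l₁, l₂, l₃]
    (by simp [Fin.forall_fin_succ, *]) (by simp [Fin.forall_fin_succ, *]) r
  simp only [Fin.sum_univ_three] at h
  norm_num at h
  exact h

/-! ### The avoidance bound and the reduction of its moments to numbers of leaves. -/

namespace TernTree

/-- Two bounds, plus one, for the number of internal nodes in a subtree that, for each node whose
children are all internal, avoids one of the nine grandchildren. The second one applies if one
child of the root is avoided. -/
def avoidBounds : TernTree → ℕ × ℕ
  | leaf => (1, 1)
  | node a b c =>
    (max (max (a.avoidBounds.2 + b.avoidBounds.1 + c.avoidBounds.1)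
      (b.avoidBounds.2 + a.avoidBounds.1 + c.avoidBounds.1))
      (c.avoidBounds.2 + b.avoidBounds.1 + a.avoidBounds.1),
    max (max (b.avoidBounds.1 + c.avoidBounds.1) (a.avoidBounds.1 + c.avoidBounds.1))
      (b.avoidBounds.1 + a.avoidBounds.1))

/-- The first component of `avoidBounds`. -/
def avoidBound (T : TernTree) : ℕ := T.avoidBounds.1

/-- The second component of `avoidBounds`. -/
def avoidChildBound (T : TernTree) : ℕ := T.avoidBounds.2

theorem avoidBound_leaf : avoidBound leaf = 1 := rfl

theorem avoidChildBound_leaf : avoidChildBound leaf = 1 := rfl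

theorem avoidBound_node (a b c : TernTree) : avoidBound (node a b c) =
    max (max (a.avoidChildBound + b.avoidBound + c.avoidBound)
      (b.avoidChildBound + a.avoidBound + c.avoidBound))
      (c.avoidChildBound + b.avoidBound + a.avoidBound) := rfl

theorem avoidChildBound_node (a b c : TernTree) : avoidChildBound (node a b c) =
    max (max (b.avoidBound + c.avoidBound) (a.avoidBound + c.avoidBound))
      (b.avoidBound + a.avoidBound) := rfl

theorem avoidBounds_le (T : TernTree) :
    T.avoidBound ≤ 2 * T.size + 1 ∧ T.avoidChildBound ≤ 2 * T.size + 1 := by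
  induction T with
  | leaf => simp [avoidBound_leaf, avoidChildBound_leaf]
  | node a b c ha hb hc =>
    simp only [avoidBound_node, avoidChildBound_node, size]
    omega

/-- The value of `avoidChildBound` if the first child is the one to be avoided. -/
def avoidFirst : TernTree → ℕ
  | leaf => 1
  | node _ b c => b.avoidBound + c.avoidBound

/-- The number of leaves outside the first subtree. -/
def leavesOffFirst : TernTree → ℕ
  | leaf => 1
  | node _ b c => (2 * b.size + 1) + (2 * c.size + 1)

/-- The size of the first subtree. -/
def firstSize : TernTree → ℕ
  | leaf => 0
  | node a _ _ => a.size

/-- Exchange of the first two children of the root. -/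
def swap₁₂ : TernTree → TernTree
  | leaf => leaf
  | node a b c => node b a c

/-- Exchange of the first and the last child of the root. -/
def swap₁₃ : TernTree → TernTree
  | leaf => leaf
  | node a b c => node c b a

theorem mass₃_swap₁₃ (n : ℕ) (G : TernTree → TernTree → TernTree → ℝ) :
    mass₃ n (fun A B C => G C B A) = mass₃ n G :=
  (mass₃_swap₁₂ n fun A B C => G C B A).symm.trans
    ((mass₃_swap₂₃ n fun A B C => G C A B).symm.trans (mass₃_swap₁₂ n G))

theorem mass_swap₁₂ (n : ℕ) (g : TernTree → ℝ) : mass n (fun T => g T.swap₁₂) = mass n g := by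
  cases n with
  | zero => rfl
  | succ n =>
    refine mul_left_cancel₀ (a := (n : ℝ) + 1) (by positivity) ?_
    rw [mass_succ_eq_mass₃, mass_succ_eq_mass₃]
    exact mass₃_swap₁₂ n fun A B C => g (node A B C)

theorem mass_swap₁₃ (n : ℕ) (g : TernTree → ℝ) : mass n (fun T => g T.swap₁₃) = mass n g := by
  cases n with
  | zero => rfl
  | succ n =>
    refine mul_left_cancel₀ (a := (n : ℝ) + 1) (by positivity) ?_
    rw [mass_succ_eq_mass₃, mass_succ_eq_mass₃]
    exact mass₃_swap₁₃ n fun A B C => g (node A B C)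

/-- A union bound over the child to be avoided; the mass is invariant under permuting the children
of the root. -/
theorem mass_avoidChildBound_le (n : ℕ) {f : ℝ → ℝ} (hf : ∀ x, 0 ≤ x → 0 ≤ f x) :
    mass n (fun T => f T.avoidChildBound) ≤ 3 * mass n fun T => f T.avoidFirst := by
  have h : mass n (fun T => f T.avoidChildBound) ≤
      mass n fun T => f T.avoidFirst + f T.swap₁₂.avoidFirst + f T.swap₁₃.avoidFirst := by
    refine mass_mono fun T _ => ?_
    have h1 := hf T.avoidFirst (by positivity)
    have h2 := hf T.swap₁₂.avoidFirst (by positivity)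
    have h3 := hf T.swap₁₃.avoidFirst (by positivity)
    have : T.avoidChildBound = T.avoidFirst ∨ T.avoidChildBound = T.swap₁₂.avoidFirst ∨
        T.avoidChildBound = T.swap₁₃.avoidFirst := by
      cases T with
      | leaf => simp [avoidChildBound_leaf, avoidFirst]
      | node a b c =>
        simp only [avoidChildBound_node, avoidFirst, swap₁₂, swap₁₃]
        omega
    rcases this with h | h | h <;> rw [h] <;> linarith
  rw [mass_add, mass_add, mass_swap₁₂ n fun T => f T.avoidFirst,
    mass_swap₁₃ n fun T => f T.avoidFirst] at h
  linarith

/-- The maximum over the nine grandchildren is replaced by a sum, and by symmetry each term is the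
one in which the first child of the first child is avoided. The factor is `9 = 3 * 3`, one `3` for
each level. -/
theorem mass_avoidBound_pow_le_mass₃ (n p : ℕ) :
    ((n : ℝ) + 1) * mass (n + 1) (fun T => (T.avoidBound : ℝ) ^ p) ≤
      9 * mass₃ n fun A B C => ((A.avoidFirst : ℝ) + B.avoidBound + C.avoidBound) ^ p := by
  rw [mass_succ_eq_mass₃]
  have h : mass₃ n (fun A B C => ((node A B C).avoidBound : ℝ) ^ p) ≤ mass₃ n fun A B C =>
      ((A.avoidChildBound : ℝ) + B.avoidBound + C.avoidBound) ^ p +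
      ((B.avoidChildBound : ℝ) + A.avoidBound + C.avoidBound) ^ p +
      ((C.avoidChildBound : ℝ) + B.avoidBound + A.avoidBound) ^ p := by
    refine mass₃_mono fun A B C _ => ?_
    have h1 : (0 : ℝ) ≤ ((A.avoidChildBound : ℝ) + B.avoidBound + C.avoidBound) ^ p := by
      positivity
    have h2 : (0 : ℝ) ≤ ((B.avoidChildBound : ℝ) + A.avoidBound + C.avoidBound) ^ p := by
      positivity
    have h3 : (0 : ℝ) ≤ ((C.avoidChildBound : ℝ) + B.avoidBound + A.avoidBound) ^ p := by
      positivity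
    have : (node A B C).avoidBound = A.avoidChildBound + B.avoidBound + C.avoidBound ∨
        (node A B C).avoidBound = B.avoidChildBound + A.avoidBound + C.avoidBound ∨
        (node A B C).avoidBound = C.avoidChildBound + B.avoidBound + A.avoidBound := by
      rw [avoidBound_node]
      omega
    rcases this with h | h | h <;> rw [h] <;> push_cast <;> linarith
  rw [mass₃_add, mass₃_add,
    mass₃_swap₁₂ n fun A B C => ((A.avoidChildBound : ℝ) + B.avoidBound + C.avoidBound) ^ p,
    mass₃_swap₁₃ n fun A B C => ((A.avoidChildBound : ℝ) + B.avoidBound + C.avoidBound) ^ p] at h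
  have h' : mass₃ n (fun A B C => ((A.avoidChildBound : ℝ) + B.avoidBound + C.avoidBound) ^ p) ≤
      3 * mass₃ n fun A B C => ((A.avoidFirst : ℝ) + B.avoidBound + C.avoidBound) ^ p := by
    rw [mass₃, mass₃, Finset.mul_sum]
    refine Finset.sum_le_sum fun x _ => ?_
    rw [mass_comm x.1 (mass x.2.1), mass_comm x.1 (mass x.2.1), ← mass_const_mul]
    refine mass_mono fun B _ => ?_
    rw [mass_comm x.1 (mass x.2.2), mass_comm x.1 (mass x.2.2), ← mass_const_mul]
    refine mass_mono fun C _ => ?_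
    exact mass_avoidChildBound_le x.1 (f := fun y => (y + B.avoidBound + C.avoidBound) ^ p)
      fun y hy => by positivity
  linarith

theorem leavesOffFirst_pos (T : TernTree) : (0 : ℝ) < T.leavesOffFirst := by
  cases T <;> simp only [leavesOffFirst] <;> positivity

/-- Hölder over the two subtrees that are kept costs `2 ^ 3 = 8`; the induction hypothesis makes
each term linear in its number of leaves, and these numbers add up to `leavesOffFirst`. The weight
`φ` is carried along because the outer Hölder step, over the three children, yields a factor
depending on `leavesOffFirst`. -/
theorem mass_avoidFirst_pow_le {r a : ℕ} {β : ℝ} (hβ : 1 ≤ β)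
    (ih : ∀ m < a, mass m (fun T => (T.avoidBound : ℝ) ^ (r + 4)) ≤
      β * (2 * m + 1) ^ (r + 1) * totalMass m)
    {φ : ℝ → ℝ} (hφ : ∀ x, 0 < x → 0 ≤ φ x) :
    mass a (fun A => φ A.leavesOffFirst * (A.avoidFirst : ℝ) ^ (r + 4)) ≤
      8 * β * mass a fun A => φ A.leavesOffFirst * (A.leavesOffFirst : ℝ) ^ (r + 1) := by
  cases a with
  | zero =>
    have := hφ 1 one_pos
    simp only [mass_zero, leavesOffFirst, avoidFirst]
    norm_num
    nlinarith
  | succ n =>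
    refine le_of_mul_le_mul_left (a := (n : ℝ) + 1) ?_ (by positivity)
    rw [mul_left_comm, mass_succ_eq_mass₃, mass_succ_eq_mass₃, mass₃, mass₃, Finset.mul_sum]
    refine Finset.sum_le_sum fun x hx => ?_
    obtain ⟨u, v, w⟩ := x
    rw [mem_triples] at hx
    simp only at hx ⊢
    set lv : ℝ := 2 * v + 1 with hlv
    set lw : ℝ := 2 * w + 1 with hlw
    have hv : 0 < lv := by positivity
    have hw : 0 < lw := by positivity
    have h0 := hφ (lv + lw) (by positivity)
    have e1 : (mass u fun A => mass v fun B => mass w fun C =>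
        φ (node A B C).leavesOffFirst * ((node A B C).leavesOffFirst : ℝ) ^ (r + 1)) =
        φ (lv + lw) * (lv + lw) ^ (r + 1) * totalMass w * totalMass v * totalMass u := by
      rw [← mass_const, ← mass_const, ← mass_const]
      refine mass_congr fun A _ => mass_congr fun B hB => mass_congr fun C hC => ?_
      simp [leavesOffFirst, hB, hC, hlv, hlw]
    have e2 : (mass u fun A => mass v fun B => mass w fun C =>
        φ (node A B C).leavesOffFirst * ((node A B C).avoidFirst : ℝ) ^ (r + 4)) ≤
        mass u fun A => mass v fun B => mass w fun C => φ (lv + lw) * (8 * (lv + lw) ^ r) *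
          ((B.avoidBound : ℝ) ^ (r + 4) / lv ^ r + (C.avoidBound : ℝ) ^ (r + 4) / lw ^ r) := by
      refine mass_mono fun A _ => mass_mono fun B hB => mass_mono fun C hC => ?_
      have : ((node A B C).leavesOffFirst : ℝ) = lv + lw := by
        simp [leavesOffFirst, hB, hC, hlv, hlw]
      rw [this, mul_assoc]
      refine mul_le_mul_of_nonneg_left ?_ h0
      simp only [avoidFirst]
      push_cast
      exact add_pow_le_mul_div_add_div (by positivity) (by positivity) hv hw r
    refine e2.trans ?_
    rw [e1]
    simp only [mass_const_mul, mass_add, mass_const, div_eq_mul_inv, mass_mul_const]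
    have i1 := ih v (by omega)
    have i2 := ih w (by omega)
    rw [← hlv] at i1
    rw [← hlw] at i2
    set mv := mass v fun T => (T.avoidBound : ℝ) ^ (r + 4)
    set mw := mass w fun T => (T.avoidBound : ℝ) ^ (r + 4)
    have j1 : mv * (lv ^ r)⁻¹ ≤ β * lv * totalMass v := by
      rw [← div_eq_mul_inv, div_le_iff₀ (by positivity)]
      refine i1.trans_eq ?_
      ring
    have j2 : mw * (lw ^ r)⁻¹ ≤ β * lw * totalMass w := by
      rw [← div_eq_mul_inv, div_le_iff₀ (by positivity)]
      refine i2.trans_eq ?_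
      ring
    have pu := totalMass_pos u
    have pv := totalMass_pos v
    have pw := totalMass_pos w
    calc _ = φ (lv + lw) * (8 * (lv + lw) ^ r) * totalMass u *
          (mv * (lv ^ r)⁻¹ * totalMass w + mw * (lw ^ r)⁻¹ * totalMass v) := by ring
      _ ≤ φ (lv + lw) * (8 * (lv + lw) ^ r) * totalMass u *
          (β * lv * totalMass v * totalMass w + β * lw * totalMass w * totalMass v) := by
        gcongr
      _ = _ := by ring

/-- Hölder at the root costs `3 ^ 3 = 27`. The second and third subtrees are handled by the
induction hypothesis, the first by `mass_avoidFirst_pow_le`, whence `216 = 27 * 8`. -/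
theorem mass₃_avoid_pow_le {r n : ℕ} {β : ℝ} (hβ : 1 ≤ β)
    (ih : ∀ m ≤ n, mass m (fun T => (T.avoidBound : ℝ) ^ (r + 4)) ≤
      β * (2 * m + 1) ^ (r + 1) * totalMass m) :
    mass₃ n (fun A B C => ((A.avoidFirst : ℝ) + B.avoidBound + C.avoidBound) ^ (r + 4)) ≤
      216 * β * mass₃ n fun A B C =>
        ((A.leavesOffFirst : ℝ) + (2 * B.size + 1) + (2 * C.size + 1)) ^ (r + 1) := by
  rw [mass₃, mass₃, Finset.mul_sum]
  refine Finset.sum_le_sum fun x hx => ?_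
  obtain ⟨a, b, c⟩ := x
  rw [mem_triples] at hx
  simp only at hx ⊢
  set lb : ℝ := 2 * b + 1 with hlb
  set lc : ℝ := 2 * c + 1 with hlc
  have hb : 0 < lb := by positivity
  have hc : 0 < lc := by positivity
  have pa := totalMass_pos a
  have pb := totalMass_pos b
  have pc := totalMass_pos c
  have i1 := ih b (by omega)
  have i2 := ih c (by omega)
  rw [← hlb] at i1
  rw [← hlc] at i2
  have e1 : (mass a fun A => mass b fun B => mass c fun C =>
      ((A.leavesOffFirst : ℝ) + (2 * B.size + 1) + (2 * C.size + 1)) ^ (r + 1)) =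
      mass a fun A => ((A.leavesOffFirst : ℝ) + lb + lc) ^ (r + 1) * (totalMass c * totalMass b) := by
    refine mass_congr fun A _ => ?_
    rw [← mul_assoc, ← mass_const, ← mass_const]
    refine mass_congr fun B hB => mass_congr fun C hC => ?_
    rw [hB, hC]
  have e2 : (mass a fun A => mass b fun B => mass c fun C =>
      ((A.avoidFirst : ℝ) + B.avoidBound + C.avoidBound) ^ (r + 4)) ≤
      mass a fun A => 27 * (((A.leavesOffFirst : ℝ) + lb + lc) ^ r /
        (A.leavesOffFirst : ℝ) ^ r * (A.avoidFirst : ℝ) ^ (r + 4) +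
        ((A.leavesOffFirst : ℝ) + lb + lc) ^ r * (β * lb + β * lc)) *
        (totalMass c * totalMass b) := by
    refine mass_mono fun A _ => ?_
    have hA := A.leavesOffFirst_pos
    set e : ℝ := (A.leavesOffFirst : ℝ)
    have : (mass b fun B => mass c fun C =>
        ((A.avoidFirst : ℝ) + B.avoidBound + C.avoidBound) ^ (r + 4)) ≤
        mass b fun B => mass c fun C => 27 * (e + lb + lc) ^ r *
        ((A.avoidFirst : ℝ) ^ (r + 4) / e ^ r + (B.avoidBound : ℝ) ^ (r + 4) / lb ^ r +
          (C.avoidBound : ℝ) ^ (r + 4) / lc ^ r) :=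
      mass_mono fun B _ => mass_mono fun C _ =>
        add_add_pow_le_mul_div_add_div (by positivity) (by positivity) (by positivity) hA hb hc r
    refine this.trans ?_
    simp only [mass_const_mul, mass_add, mass_const, div_eq_mul_inv, mass_mul_const]
    set mb := mass b fun T => (T.avoidBound : ℝ) ^ (r + 4)
    set mc := mass c fun T => (T.avoidBound : ℝ) ^ (r + 4)
    have j1 : mb * (lb ^ r)⁻¹ ≤ β * lb * totalMass b := by
      rw [← div_eq_mul_inv, div_le_iff₀ (by positivity)]
      refine i1.trans_eq ?_
      ring
    have j2 : mc * (lc ^ r)⁻¹ ≤ β * lc * totalMass c := by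
      rw [← div_eq_mul_inv, div_le_iff₀ (by positivity)]
      refine i2.trans_eq ?_
      ring
    calc _ = 27 * (e + lb + lc) ^ r *
          ((A.avoidFirst : ℝ) ^ (r + 4) * (e ^ r)⁻¹ * (totalMass c * totalMass b) +
          mb * (lb ^ r)⁻¹ * totalMass c + mc * (lc ^ r)⁻¹ * totalMass b) := by ring
      _ ≤ 27 * (e + lb + lc) ^ r *
          ((A.avoidFirst : ℝ) ^ (r + 4) * (e ^ r)⁻¹ * (totalMass c * totalMass b) +
          β * lb * totalMass b * totalMass c + β * lc * totalMass c * totalMass b) := by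
        gcongr
      _ = _ := by ring
  have e3 := mass_avoidFirst_pow_le hβ (fun m hm => ih m (by omega))
    (φ := fun y => (y + lb + lc) ^ r / y ^ r) (a := a) (r := r) (fun y hy => by positivity)
  have e4 : (mass a fun A => ((A.leavesOffFirst : ℝ) + lb + lc) ^ r / (A.leavesOffFirst : ℝ) ^ r *
      (A.leavesOffFirst : ℝ) ^ (r + 1)) =
      mass a fun A => ((A.leavesOffFirst : ℝ) + lb + lc) ^ r * A.leavesOffFirst := by
    refine mass_congr fun A _ => ?_
    have := A.leavesOffFirst_pos
    field_simp
    ring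
  have e5 : (mass a fun A => ((A.leavesOffFirst : ℝ) + lb + lc) ^ (r + 1)) =
      mass a (fun A => ((A.leavesOffFirst : ℝ) + lb + lc) ^ r * A.leavesOffFirst) +
      mass a (fun A => ((A.leavesOffFirst : ℝ) + lb + lc) ^ r) * (lb + lc) := by
    rw [← mass_mul_const, ← mass_add]
    refine mass_congr fun A _ => ?_
    ring
  rw [e4] at e3
  refine e2.trans ?_
  rw [e1, mass_mul_const, mass_mul_const, mass_const_mul, mass_add, mass_mul_const, e5,
    ← mul_assoc (216 * β)]
  refine mul_le_mul_of_nonneg_right ?_ (by positivity)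
  have e6 : 0 ≤ mass a fun A => ((A.leavesOffFirst : ℝ) + lb + lc) ^ r := by
    have := mass_mono (n := a) (f := fun _ => 0)
      (g := fun A => ((A.leavesOffFirst : ℝ) + lb + lc) ^ r) fun A _ => by positivity
    rwa [mass_const, zero_mul] at this
  have e7 : 0 ≤ β * (mass a (fun A => ((A.leavesOffFirst : ℝ) + lb + lc) ^ r) * (lb + lc)) := by
    positivity
  -- The first subtree uses the full factor `27 * 8`; the other two need only `27`, and `e7` absorbs
  -- the difference.
  nlinarith

/-! ### Asymptotics of the total mass and the size of a given subtree. -/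

/-- The generating function of `totalMass` is `(1 - 2 * x) ^ (-1 / 2)`, whose square is geometric.
The proof weights each pair by the sum of its indices and applies the recursion to each index. -/
theorem sum_antidiagonal_totalMass (n : ℕ) :
    ∑ x ∈ Finset.HasAntidiagonal.antidiagonal n, totalMass x.1 * totalMass x.2 = 2 ^ n := by
  induction n with
  | zero => simp [totalMass_zero]
  | succ n ih =>
    refine mul_left_cancel₀ (a := (n : ℝ) + 1) (by positivity) ?_
    have h1 : ∑ x ∈ Finset.HasAntidiagonal.antidiagonal (n + 1), (x.1 : ℝ) * (totalMass x.1 * totalMass x.2) =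
        ∑ x ∈ Finset.HasAntidiagonal.antidiagonal n, (2 * (x.1 : ℝ) + 1) * (totalMass x.1 * totalMass x.2) := by
      rw [Finset.Nat.sum_antidiagonal_succ]
      simp only [Nat.cast_zero, zero_mul, zero_add]
      refine Finset.sum_congr rfl fun x _ => ?_
      rw [← mul_assoc, ← mul_assoc, ← totalMass_succ]
      push_cast
      rfl
    have h2 : ∑ x ∈ Finset.HasAntidiagonal.antidiagonal (n + 1), (x.2 : ℝ) * (totalMass x.1 * totalMass x.2) =
        ∑ x ∈ Finset.HasAntidiagonal.antidiagonal n, (2 * (x.2 : ℝ) + 1) * (totalMass x.1 * totalMass x.2) := by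
      rw [← Finset.Nat.sum_antidiagonal_swap, ← Finset.Nat.sum_antidiagonal_swap (n := n)]
      simpa only [Prod.fst_swap, Prod.snd_swap, mul_comm] using h1
    have h3 : ((n : ℝ) + 1) * ∑ x ∈ Finset.HasAntidiagonal.antidiagonal (n + 1), totalMass x.1 * totalMass x.2 =
        ∑ x ∈ Finset.HasAntidiagonal.antidiagonal (n + 1), (x.1 : ℝ) * (totalMass x.1 * totalMass x.2) +
        ∑ x ∈ Finset.HasAntidiagonal.antidiagonal (n + 1), (x.2 : ℝ) * (totalMass x.1 * totalMass x.2) := by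
      rw [← Finset.sum_add_distrib, Finset.mul_sum]
      refine Finset.sum_congr rfl fun x hx => ?_
      rw [← add_mul, ← Nat.cast_add, Finset.HasAntidiagonal.mem_antidiagonal.1 hx]
      push_cast
      rfl
    rw [h3, h1, h2, ← Finset.sum_add_distrib, pow_succ, ← ih, Finset.sum_mul, Finset.mul_sum]
    refine Finset.sum_congr rfl fun x hx => ?_
    have : (x.1 : ℝ) + x.2 = n := by exact_mod_cast Finset.HasAntidiagonal.mem_antidiagonal.1 hx
    rw [← this]
    ring

theorem sum_triples_totalMass (n : ℕ) (f : ℕ → ℝ) :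
    ∑ x ∈ triples n, f x.1 * (totalMass x.1 * totalMass x.2.1 * totalMass x.2.2) =
      ∑ a ∈ Finset.range (n + 1), f a * totalMass a * 2 ^ (n - a) := by
  simp only [← sum_antidiagonal_totalMass, Finset.mul_sum]
  rw [Finset.sum_sigma']
  refine Finset.sum_nbij' (fun x => ⟨x.1, x.2.1, x.2.2⟩) (fun x => (x.1, x.2.1, x.2.2))
    ?_ ?_ ?_ ?_ ?_
  · intro x hx
    simp only [mem_triples, Finset.mem_sigma, Finset.mem_range, Finset.HasAntidiagonal.mem_antidiagonal] at *
    omega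
  · intro x hx
    simp only [mem_triples, Finset.mem_sigma, Finset.mem_range, Finset.HasAntidiagonal.mem_antidiagonal] at *
    omega
  · intro x _; rfl
  · intro x _; rfl
  · intro x _
    ring

theorem sum_range_totalMass_div (m : ℕ) :
    ∑ a ∈ Finset.range m, totalMass a / 2 ^ a = 2 * m * (totalMass m / 2 ^ m) := by
  induction m with
  | zero => simp
  | succ m ih =>
    rw [Finset.sum_range_succ, ih]
    have h := totalMass_succ m
    push_cast
    rw [pow_succ]
    field_simp
    linarith

/-- Here `totalMass n / 2 ^ n` is the central binomial probability, of order `1 / √n`. Monotonicity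
compares its values at two indices without an asymptotic formula. -/
theorem monotone_sqrt_mul_totalMass :
    Monotone fun n : ℕ => √n * (totalMass n / 2 ^ n) := by
  refine monotone_nat_of_le_succ fun n => ?_
  have h := totalMass_succ n
  have p0 := totalMass_pos n
  have p1 := totalMass_pos (n + 1)
  refine abs_le_of_sq_le_sq' ?_ (by positivity) |>.2
  rw [mul_pow, mul_pow, Real.sq_sqrt (by positivity), Real.sq_sqrt (by positivity),
    pow_succ (2 : ℝ) n]
  have h1 : totalMass (n + 1) = (2 * n + 1) * totalMass n / (n + 1) := by
    rw [← h]; field_simp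
  rw [h1]
  push_cast
  have h2 : ((2 * n + 1) * totalMass n / (n + 1) / (2 ^ n * 2)) ^ 2 =
      ((2 * n + 1) / (2 * (n + 1))) ^ 2 * (totalMass n / 2 ^ n) ^ 2 := by
    rw [← mul_pow]; congr 1; field_simp
  rw [h2, ← mul_assoc]
  refine mul_le_mul_of_nonneg_right ?_ (by positivity)
  rw [div_pow, ← mul_div_assoc, le_div_iff₀ (by positivity)]
  have : (0 : ℝ) ≤ n := by positivity
  nlinarith

/-- The size of the first subtree is less than `m` with probability at most `√(m / n)`. -/
theorem mass_firstSize_lt_le {n m : ℕ} (hm : m ≤ n) (hn : 0 < n) :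
    mass n (fun T => if T.firstSize < m then 1 else 0) ≤ √(m / n) * totalMass n := by
  obtain ⟨n, rfl⟩ : ∃ k, n = k + 1 := ⟨n - 1, by omega⟩
  refine le_of_mul_le_mul_left (a := (n : ℝ) + 1) ?_ (by positivity)
  have e1 : mass₃ n (fun A B C => if (node A B C).firstSize < m then 1 else 0) =
      ∑ x ∈ triples n, (if x.1 < m then 1 else 0) *
        (totalMass x.1 * totalMass x.2.1 * totalMass x.2.2) := by
    refine Finset.sum_congr rfl fun x _ => ?_
    have : (mass x.1 fun A => mass x.2.1 fun B => mass x.2.2 fun C =>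
        if (node A B C).firstSize < m then (1 : ℝ) else 0) = mass x.1 fun A => mass x.2.1 fun B =>
          mass x.2.2 fun C => if x.1 < m then (1 : ℝ) else 0 :=
      mass_congr fun A hA => mass_congr fun B _ => mass_congr fun C _ => by
        simp only [firstSize, hA]
    rw [this]
    simp only [mass_const]
    ring
  have e2 : ∑ a ∈ Finset.range (n + 1), (if a < m then 1 else 0) * totalMass a * 2 ^ (n - a) =
      2 ^ n * ∑ a ∈ Finset.range m, totalMass a / 2 ^ a := by
    rw [Finset.mul_sum, ← Finset.sum_subset (Finset.range_subset_range.2 hm)]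
    · refine Finset.sum_congr rfl fun a ha => ?_
      rw [Finset.mem_range] at ha
      rw [if_pos ha, pow_sub₀ _ two_ne_zero (by omega)]
      ring
    · intro a _ ha
      rw [Finset.mem_range] at ha
      simp [ha]
  rw [mass_succ_eq_mass₃, e1, sum_triples_totalMass n fun a => if a < m then 1 else 0, e2,
    sum_range_totalMass_div]
  have h := monotone_sqrt_mul_totalMass hm
  simp only at h
  have h3 : (m : ℝ) = √m * √m := (Real.mul_self_sqrt (by positivity)).symm
  have h4 : ((n + 1 : ℕ) : ℝ) = √(n + 1 : ℕ) * √(n + 1 : ℕ) :=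
    (Real.mul_self_sqrt (by positivity)).symm
  calc (2 : ℝ) ^ n * (2 * m * (totalMass m / 2 ^ m)) =
        2 ^ (n + 1) * √m * (√m * (totalMass m / 2 ^ m)) := by
        nth_rewrite 1 [h3]
        ring
    _ ≤ 2 ^ (n + 1) * √m * (√(n + 1 : ℕ) * (totalMass (n + 1) / 2 ^ (n + 1))) := by gcongr
    _ = ((n + 1 : ℕ) : ℝ) * (√(m / (n + 1 : ℕ)) * totalMass (n + 1)) := by
        rw [Real.sqrt_div (by positivity)]
        nth_rewrite 2 [h4]
        have : √(n + 1 : ℕ) ≠ 0 := by positivity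
        field_simp
    _ = _ := by push_cast; ring

/-- Take `m = n / K + 1` in `mass_firstSize_lt_le`; since `K ≤ n`, the ratio `m / n` is at most `2 /
K`. -/
theorem mass_firstSize_mul_lt_le {n K : ℕ} (hK : 2 ≤ K) (hn : K ≤ n) :
    mass n (fun T => if K * T.firstSize < n then 1 else 0) ≤ √(2 / K) * totalMass n := by
  have hm : n / K + 1 ≤ n := by
    have := Nat.div_le_div_left (a := n) hK two_pos
    omega
  have h := mass_firstSize_lt_le hm (by omega)
  refine (mass_mono fun T _ => ?_).trans (h.trans ?_)
  · by_cases h1 : K * T.firstSize < n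
    · have : T.firstSize ≤ n / K := (Nat.le_div_iff_mul_le (by omega)).2 (by rw [mul_comm]; omega)
      rw [if_pos h1, if_pos (by omega)]
    · rw [if_neg h1]
      split_ifs <;> norm_num
  · refine mul_le_mul_of_nonneg_right (Real.sqrt_le_sqrt ?_) (totalMass_pos n).le
    have hK0 : (0 : ℝ) < K := by exact_mod_cast (by omega : 0 < K)
    have hn0 : (0 : ℝ) < n := by exact_mod_cast (by omega : 0 < n)
    rw [div_le_div_iff₀ hn0 hK0]
    have : (n / K + 1) * K ≤ 2 * n := by
      have := Nat.div_mul_le_self n K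
      rw [add_mul]; omega
    exact_mod_cast this

/-! ### The moment bound. -/

theorem mass₃_one (n : ℕ) : mass₃ n (fun _ _ _ => 1) = ((n : ℝ) + 1) * totalMass (n + 1) := by
  rw [totalMass, mass_succ_eq_mass₃]

/-- Either the first child is small, or its own first child is small relative to it, or the avoided
grandchild holds at least the proportion `1 / K ^ 2` of all leaves. In the first two cases the
number of remaining leaves is bounded trivially by the number of all leaves. -/
theorem leavesOffFirst_pow_le {n K q : ℕ} (hK : 2 ≤ K) {A B C : TernTree}
    (h : A.size + B.size + C.size = n) :
    ((A.leavesOffFirst : ℝ) + (2 * B.size + 1) + (2 * C.size + 1)) ^ q ≤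
      (2 * (n + 1 : ℕ) + 1) ^ q * ((if K * A.size < n + 1 then 1 else 0) +
        (if n + 1 ≤ K * A.size ∧ K * A.firstSize < A.size then 1 else 0) +
        (1 - 1 / (K : ℝ) ^ 2) ^ q) := by
  have hK0 : (2 : ℝ) ≤ K := by exact_mod_cast hK
  have hK1 : 0 ≤ 1 - 1 / (K : ℝ) ^ 2 := by
    rw [sub_nonneg, div_le_one (by positivity)]; nlinarith
  have hA : A.leavesOffFirst ≤ 2 * A.size + 1 := by
    cases A with
    | leaf => simp [leavesOffFirst]
    | node a b c => simp only [leavesOffFirst, size]; omega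
  have hN : (A.leavesOffFirst : ℝ) + (2 * B.size + 1) + (2 * C.size + 1) ≤
      2 * (n + 1 : ℕ) + 1 := by
    have : A.leavesOffFirst + (2 * B.size + 1) + (2 * C.size + 1) ≤ 2 * (n + 1) + 1 := by omega
    exact_mod_cast this
  have hNq := pow_le_pow_left₀ (by positivity) hN q
  have hp : (0 : ℝ) ≤ (2 * (n + 1 : ℕ) + 1) ^ q := by positivity
  have hkq : 0 ≤ (1 - 1 / (K : ℝ) ^ 2) ^ q := by positivity
  by_cases h1 : K * A.size < n + 1
  · rw [if_pos h1, if_neg (by omega)]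
    nlinarith
  by_cases h2 : K * A.firstSize < A.size
  · rw [if_neg h1, if_pos ⟨by omega, h2⟩]
    nlinarith
  rw [if_neg h1, if_neg (fun h => h2 h.2), zero_add, zero_add, ← mul_pow]
  refine pow_le_pow_left₀ (by positivity) ?_ q
  have hA' : A.leavesOffFirst + (2 * A.firstSize + 1) = 2 * A.size + 1 := by
    cases A with
    | leaf => simp [size] at h1
    | node a b c => simp only [leavesOffFirst, firstSize, size]; omega
  have h3 : (2 * (n + 1) + 1) ≤ K ^ 2 * (2 * A.firstSize + 1) := by nlinarith
  have h4 : (2 * ((n + 1 : ℕ) : ℝ) + 1) ≤ (K : ℝ) ^ 2 * (2 * A.firstSize + 1) := by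
    exact_mod_cast h3
  have h5 : (A.leavesOffFirst : ℝ) + (2 * B.size + 1) + (2 * C.size + 1) + (2 * A.firstSize + 1) =
      2 * (n + 1 : ℕ) + 1 := by
    have : A.leavesOffFirst + (2 * B.size + 1) + (2 * C.size + 1) + (2 * A.firstSize + 1) =
      2 * (n + 1) + 1 := by omega
    exact_mod_cast this
  have h6 : (2 * ((n + 1 : ℕ) : ℝ) + 1) * (1 / (K : ℝ) ^ 2) ≤ 2 * A.firstSize + 1 := by
    rw [mul_one_div, div_le_iff₀ (by positivity)]
    linarith
  linarith

theorem mass₃_leavesOffFirst_pow_le {n K q : ℕ} (hK : 2 ≤ K) (hn : K ^ 2 ≤ n + 1) :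
    mass₃ n (fun A B C =>
      ((A.leavesOffFirst : ℝ) + (2 * B.size + 1) + (2 * C.size + 1)) ^ q) ≤
      (2 * √(2 / K) + (1 - 1 / (K : ℝ) ^ 2) ^ q) * (2 * (n + 1 : ℕ) + 1) ^ q *
        (((n : ℝ) + 1) * totalMass (n + 1)) := by
  refine (mass₃_mono fun A B C h => leavesOffFirst_pow_le (q := q) hK h).trans ?_
  rw [mass₃_const_mul, mass₃_add, mass₃_add]
  have h1 : mass₃ n (fun A _ _ => if K * A.size < n + 1 then 1 else 0) ≤
      √(2 / K) * (((n : ℝ) + 1) * totalMass (n + 1)) := by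
    have h := mass_succ_eq_mass₃ n fun T => if K * T.firstSize < n + 1 then 1 else 0
    refine h.symm.trans_le ?_
    rw [mul_left_comm]
    refine mul_le_mul_of_nonneg_left (mass_firstSize_mul_lt_le hK (by nlinarith)) (by positivity)
  have h2 : mass₃ n (fun A _ _ =>
      if n + 1 ≤ K * A.size ∧ K * A.firstSize < A.size then 1 else 0) ≤
      √(2 / K) * (((n : ℝ) + 1) * totalMass (n + 1)) := by
    rw [← mass₃_one, mass₃, mass₃, Finset.mul_sum]
    refine Finset.sum_le_sum fun x _ => ?_
    simp only [mass_const, mass_mul_const]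
    have pb := totalMass_pos x.2.1
    have pc := totalMass_pos x.2.2
    have pa := totalMass_pos x.1
    have e : √(2 / (K : ℝ)) * (1 * totalMass x.2.2 * totalMass x.2.1 * totalMass x.1) =
        √(2 / (K : ℝ)) * totalMass x.1 * totalMass x.2.2 * totalMass x.2.1 := by ring
    rw [e]
    refine mul_le_mul_of_nonneg_right (mul_le_mul_of_nonneg_right ?_ pc.le) pb.le
    -- If the first child is not small, then `K ^ 2 ≤ n + 1 ≤ K * x.1`, so `K ≤ x.1` and
    -- `mass_firstSize_mul_lt_le` applies inside it.
    by_cases h : n + 1 ≤ K * x.1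
    · refine (mass_mono fun T hT => ?_).trans
        (mass_firstSize_mul_lt_le (n := x.1) hK (by nlinarith))
      rw [hT]
      simp [h]
    · have : mass x.1 (fun T => if n + 1 ≤ K * T.size ∧ K * T.firstSize < T.size
          then (1 : ℝ) else 0) = mass x.1 fun _ => (0 : ℝ) :=
        mass_congr fun T hT => by rw [hT]; simp [h]
      rw [this, mass_const, zero_mul]
      positivity
  have h3 : mass₃ n (fun _ _ _ => (1 - 1 / (K : ℝ) ^ 2) ^ q) =
      (1 - 1 / (K : ℝ) ^ 2) ^ q * (((n : ℝ) + 1) * totalMass (n + 1)) := by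
    rw [← mass₃_one, ← mass₃_const_mul]
    simp only [mul_one]
  rw [h3]
  calc _ ≤ (2 * (n + 1 : ℕ) + 1) ^ q * (√(2 / K) * (((n : ℝ) + 1) * totalMass (n + 1)) +
        √(2 / K) * (((n : ℝ) + 1) * totalMass (n + 1)) +
        (1 - 1 / (K : ℝ) ^ 2) ^ q * (((n : ℝ) + 1) * totalMass (n + 1))) := by gcongr
    _ = _ := by ring

/-- Moments of `avoidBound` for a random tree with `n` internal nodes are of smaller order than
the powers of `n`. -/
theorem exists_mass_avoidBound_pow_le : ∃ (r : ℕ) (β : ℝ), ∀ n : ℕ,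
    mass n (fun T => (T.avoidBound : ℝ) ^ (r + 4)) ≤
      β * (2 * n + 1) ^ (r + 1) * totalMass n := by
  -- The two levels contribute `2 * √(2 / K) = 1 / 4000`, and `r` makes the remaining term at most
  -- `1 / 4000`. The sum `1 / 2000` beats the loss `9 * 216 = 1944`.
  obtain ⟨K, hK⟩ : ∃ K : ℕ, K = 2 * 8000 ^ 2 := ⟨_, rfl⟩
  have hK2 : 2 ≤ K := by rw [hK]; norm_num
  have hKs : √(2 / K) = 1 / 8000 := by
    rw [hK]
    rw [show (2 : ℝ) / ((2 * 8000 ^ 2 : ℕ) : ℝ) = (1 / 8000) ^ 2 by norm_num]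
    exact Real.sqrt_sq (by norm_num)
  have hK0 : (0 : ℝ) < 1 / (K : ℝ) ^ 2 := by
    have : (0 : ℝ) < K := by exact_mod_cast (by omega : 0 < K)
    positivity
  have hK1 : 0 ≤ 1 - 1 / (K : ℝ) ^ 2 := by
    have : (2 : ℝ) ≤ K := by exact_mod_cast hK2
    rw [sub_nonneg, div_le_one (by positivity)]; nlinarith
  obtain ⟨r, hr⟩ := exists_pow_lt_of_lt_one (show (0 : ℝ) < 1 / 4000 by norm_num)
    (show 1 - 1 / (K : ℝ) ^ 2 < 1 by linarith)
  have hr' : (1 - 1 / (K : ℝ) ^ 2) ^ (r + 1) ≤ 1 / 4000 :=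
    (pow_le_pow_of_le_one hK1 (by linarith) (Nat.le_succ r)).trans hr.le
  have hβ : (1 : ℝ) ≤ (2 * (K ^ 2 : ℕ) + 1) ^ 3 :=
    one_le_pow₀ (by have : (0 : ℝ) ≤ (K ^ 2 : ℕ) := by positivity
                    linarith)
  refine ⟨r, (2 * (K ^ 2 : ℕ) + 1) ^ 3, fun n => ?_⟩
  set β : ℝ := (2 * (K ^ 2 : ℕ) + 1) ^ 3
  induction n using Nat.strong_induction_on with
  | _ n ih =>
    -- For small `n` the trivial bound `avoidBound ≤ 2 * n + 1` suffices: `β` is chosen to dominate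
    -- the three surplus factors `2 * n + 1`.
    by_cases hn : n < K ^ 2
    · have h1 : mass n (fun T => (T.avoidBound : ℝ) ^ (r + 4)) ≤
          mass n fun _ => β * (2 * n + 1) ^ (r + 1) := by
        refine mass_mono fun T hT => ?_
        have h2 : (T.avoidBound : ℝ) ≤ 2 * n + 1 := by
          have := T.avoidBounds_le.1
          rw [hT] at this
          exact_mod_cast this
        refine (pow_le_pow_left₀ (by positivity) h2 _).trans ?_
        rw [show r + 4 = 3 + (r + 1) by ring, pow_add]
        refine mul_le_mul_of_nonneg_right (pow_le_pow_left₀ (by positivity) ?_ 3) (by positivity)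
        have : (n : ℝ) ≤ (K ^ 2 : ℕ) := by exact_mod_cast hn.le
        linarith
      rwa [mass_const] at h1
    · obtain ⟨n, rfl⟩ : ∃ k, n = k + 1 := ⟨n - 1, by
        have : 0 < K ^ 2 := by positivity
        omega⟩
      refine le_of_mul_le_mul_left (a := (n : ℝ) + 1) ?_ (by positivity)
      have h1 := mass_avoidBound_pow_le_mass₃ n (r + 4)
      have h2 := mass₃_avoid_pow_le (n := n) hβ fun m hm => ih m (by omega)
      have h3 := mass₃_leavesOffFirst_pow_le (q := r + 1) hK2 (not_lt.1 hn)
      rw [hKs] at h3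
      have p := totalMass_pos (n + 1)
      calc _ ≤ 9 * (216 * β * ((2 * (1 / 8000) + 1 / 4000) * (2 * (n + 1 : ℕ) + 1) ^ (r + 1) *
            (((n : ℝ) + 1) * totalMass (n + 1)))) := by
            refine h1.trans (mul_le_mul_of_nonneg_left (h2.trans ?_) (by norm_num))
            refine mul_le_mul_of_nonneg_left (h3.trans ?_) (by positivity)
            gcongr
        _ = (9 * 216 * (2 * (1 / 8000) + 1 / 4000)) * (((n : ℝ) + 1) *
            (β * (2 * (n + 1 : ℕ) + 1) ^ (r + 1) * totalMass (n + 1))) := by ring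
        _ ≤ 1 * (((n : ℝ) + 1) *
            (β * (2 * (n + 1 : ℕ) + 1) ^ (r + 1) * totalMass (n + 1))) := by
            gcongr
            norm_num
        _ = _ := by rw [one_mul]

end TernTree

/-! ### Labelled trees and the effect of a subdivision. -/

/-- Ternary trees whose internal nodes are labelled by the vertices of a plane graph. The nodes
correspond to triangles: a leaf is a face, and the vertex `v` in `node v ch` subdivides a triangle
into three triangles, the `k`-th of which has the `k`-th corner replaced by `v`. -/
inductive LabelledTree
  | leaf : LabelledTree
  | node (v : ℕ) (ch : Fin 3 → LabelledTree) : LabelledTree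

namespace LabelledTree

/-- The ternary tree obtained by forgetting the labels. -/
def shape : LabelledTree → TernTree
  | leaf => .leaf
  | node _ ch => .node (ch 0).shape (ch 1).shape (ch 2).shape

/-- The set of labels, that is of the vertices in the interior of the triangle. -/
def verts : LabelledTree → Finset ℕ
  | leaf => ∅
  | node v ch => insert v (Finset.univ.biUnion fun k => (ch k).verts)

/-- The set of faces in a triangle with corners `x`. -/
def faces : LabelledTree → (Fin 3 → ℕ) → Finset (Finset ℕ)
  | leaf, x => {Finset.univ.image x}
  | node v ch, x => Finset.univ.biUnion fun k => (ch k).faces (Function.update x k v)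

/-- The labels and the corners are different from each other. -/
def Proper : LabelledTree → (Fin 3 → ℕ) → Prop
  | leaf, x => Function.Injective x
  | node v ch, x => Function.Injective x ∧ (∀ i, x i ≠ v) ∧ (∀ k, v ∉ (ch k).verts) ∧
      (∀ k i, x i ∉ (ch k).verts) ∧ (∀ k l, k ≠ l → Disjoint (ch k).verts (ch l).verts) ∧
      ∀ k, (ch k).Proper (Function.update x k v)

/-- The interior of each triangle is joined to its corners only. -/
def Separated (E : ℕ → ℕ → Prop) : LabelledTree → (Fin 3 → ℕ) → Prop
  | leaf, _ => True
  | node v ch, x => ∀ k, (∀ u ∈ (ch k).verts, ∀ w, E u w →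
      w ∈ (ch k).verts ∨ ∃ i, Function.update x k v i = w) ∧
      (ch k).Separated E (Function.update x k v)

/-- Subdivision of the face `F` by the vertex `n`. -/
def subdivide : LabelledTree → (Fin 3 → ℕ) → Finset ℕ → ℕ → LabelledTree
  | leaf, x, F, n => if F = Finset.univ.image x then node n fun _ => leaf else leaf
  | node v ch, x, F, n => node v fun k => (ch k).subdivide (Function.update x k v) F n

theorem mem_verts_node {v : ℕ} {ch : Fin 3 → LabelledTree} {w : ℕ} :
    w ∈ (node v ch).verts ↔ w = v ∨ ∃ k, w ∈ (ch k).verts := by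
  simp [verts]

theorem mem_faces_node {v : ℕ} {ch : Fin 3 → LabelledTree} {x : Fin 3 → ℕ} {F : Finset ℕ} :
    F ∈ (node v ch).faces x ↔ ∃ k, F ∈ (ch k).faces (Function.update x k v) := by
  simp [faces]

theorem exists_update_eq {x : Fin 3 → ℕ} {k : Fin 3} {v w : ℕ} :
    (∃ i, Function.update x k v i = w) ↔ v = w ∨ ∃ i, i ≠ k ∧ x i = w := by
  rw [Function.exists_update_iff x (p := fun _ b => b = w)]

theorem mem_or_exists_of_mem_faces {T : LabelledTree} {x : Fin 3 → ℕ} {F : Finset ℕ}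
    (hF : F ∈ T.faces x) {w : ℕ} (hw : w ∈ F) : w ∈ T.verts ∨ ∃ i, x i = w := by
  induction T generalizing x with
  | leaf =>
    rw [faces, Finset.mem_singleton] at hF
    subst hF
    simpa [verts] using hw
  | node v ch ih =>
    obtain ⟨k, hk⟩ := mem_faces_node.1 hF
    rw [mem_verts_node]
    rcases ih k hk with h | h
    · exact .inl (.inr ⟨k, h⟩)
    · rcases exists_update_eq.1 h with h | ⟨i, _, h⟩
      · exact .inl (.inl h.symm)
      · exact .inr ⟨i, h⟩

theorem Proper.card_of_mem_faces {T : LabelledTree} {x : Fin 3 → ℕ} (h : T.Proper x)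
    {F : Finset ℕ} (hF : F ∈ T.faces x) : F.card = 3 := by
  induction T generalizing x with
  | leaf =>
    rw [faces, Finset.mem_singleton] at hF
    rw [hF, Finset.card_image_of_injective _ h]
    rfl
  | node v ch ih =>
    obtain ⟨k, hk⟩ := mem_faces_node.1 hF
    exact ih k (h.2.2.2.2.2 k) hk

/-- A face inside two different parts of a triangle could only have the centre and the one corner
common to both parts as its corners, but a face has three. -/
theorem Proper.eq_of_mem_faces {v : ℕ} {ch : Fin 3 → LabelledTree} {x : Fin 3 → ℕ}
    (h : (node v ch).Proper x) {k l : Fin 3} {F : Finset ℕ}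
    (hk : F ∈ (ch k).faces (Function.update x k v))
    (hl : F ∈ (ch l).faces (Function.update x l v)) : k = l := by
  by_contra hkl
  obtain ⟨hx, -, hv, hxv, hd, hp⟩ := h
  have hsub : F ⊆ insert v ((Finset.univ \ {k, l}).image x) := by
    intro w hw
    rw [Finset.mem_insert, Finset.mem_image]
    have h1 := mem_or_exists_of_mem_faces hk hw
    have h2 := mem_or_exists_of_mem_faces hl hw
    rw [exists_update_eq] at h1 h2
    rcases h1 with h1 | rfl | ⟨i, hi, rfl⟩
    · rcases h2 with h2 | rfl | ⟨j, hj, rfl⟩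
      · exact absurd h2 (Finset.disjoint_left.1 (hd k l hkl) h1)
      · exact .inl rfl
      · exact absurd h1 (hxv k j)
    · exact .inl rfl
    · rcases h2 with h2 | rfl | ⟨j, hj, hij⟩
      · exact absurd h2 (hxv l i)
      · exact .inl rfl
      · have := hx hij
        subst this
        exact .inr ⟨j, by simp [hi, hj], rfl⟩
  have h1 := Finset.card_le_card hsub
  rw [(hp k).card_of_mem_faces hk] at h1
  have h2 := Finset.card_insert_le v ((Finset.univ \ {k, l}).image x)
  have h3 := Finset.card_image_le (s := Finset.univ \ {k, l}) (f := x)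
  have h4 : (Finset.univ \ {k, l} : Finset (Fin 3)).card = 1 := by
    rw [Finset.card_sdiff_of_subset (Finset.subset_univ _), Finset.card_pair hkl]
    rfl
  omega

theorem subdivide_of_notMem {T : LabelledTree} {x : Fin 3 → ℕ} {F : Finset ℕ}
    (hF : F ∉ T.faces x) (n : ℕ) : T.subdivide x F n = T := by
  induction T generalizing x with
  | leaf =>
    rw [faces, Finset.mem_singleton] at hF
    rw [subdivide, if_neg hF]
  | node v ch ih =>
    rw [mem_faces_node, not_exists] at hF
    rw [subdivide]
    congr 1
    funext k
    exact ih k (hF k)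

theorem Proper.subdivide_node {v : ℕ} {ch : Fin 3 → LabelledTree} {x : Fin 3 → ℕ}
    (h : (node v ch).Proper x) {k : Fin 3} {F : Finset ℕ}
    (hk : F ∈ (ch k).faces (Function.update x k v)) (n : ℕ) :
    (node v ch).subdivide x F n =
      node v (Function.update ch k ((ch k).subdivide (Function.update x k v) F n)) := by
  rw [subdivide]
  congr 1
  funext l
  by_cases hl : l = k
  · subst hl
    rw [Function.update_self]
  · rw [Function.update_of_ne hl]
    exact subdivide_of_notMem (fun h' => hl (h.eq_of_mem_faces h' hk)) n

theorem Proper.verts_subdivide {T : LabelledTree} {x : Fin 3 → ℕ} (h : T.Proper x)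
    {F : Finset ℕ} (hF : F ∈ T.faces x) (n : ℕ) :
    (T.subdivide x F n).verts = insert n T.verts := by
  induction T generalizing x with
  | leaf =>
    rw [faces, Finset.mem_singleton] at hF
    rw [subdivide, if_pos hF]
    ext w
    simp [verts]
  | node v ch ih =>
    obtain ⟨k, hk⟩ := mem_faces_node.1 hF
    rw [h.subdivide_node hk]
    ext w
    rw [Finset.mem_insert, mem_verts_node, mem_verts_node,
      Function.exists_update_iff ch (p := fun _ T => w ∈ T.verts), ih k (h.2.2.2.2.2 k) hk,
      Finset.mem_insert]
    constructor
    · rintro (h | (h | h) | ⟨l, -, h⟩)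
      exacts [.inr (.inl h), .inl h, .inr (.inr ⟨k, h⟩), .inr (.inr ⟨l, h⟩)]
    · rintro (h | h | ⟨l, h⟩)
      · exact .inr (.inl (.inl h))
      · exact .inl h
      · by_cases hl : l = k
        · subst hl
          exact .inr (.inl (.inr h))
        · exact .inr (.inr ⟨l, hl, h⟩)

theorem Proper.subdivide {T : LabelledTree} {x : Fin 3 → ℕ} (h : T.Proper x)
    {F : Finset ℕ} (hF : F ∈ T.faces x) {n : ℕ} (hn : n ∉ T.verts) (hxn : ∀ i, x i ≠ n) :
    (T.subdivide x F n).Proper x := by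
  induction T generalizing x with
  | leaf =>
    rw [faces, Finset.mem_singleton] at hF
    rw [LabelledTree.subdivide, if_pos hF]
    refine ⟨h, hxn, by simp [verts], by simp [verts], by simp [verts], fun k => ?_⟩
    change Function.Injective _
    intro i j hij
    by_cases hi : i = k
    · by_cases hj : j = k
      · rw [hi, hj]
      · rw [hi, Function.update_self, Function.update_of_ne hj] at hij
        exact absurd hij.symm (hxn j)
    · by_cases hj : j = k
      · rw [hj, Function.update_self, Function.update_of_ne hi] at hij
        exact absurd hij (hxn i)
      · rw [Function.update_of_ne hi, Function.update_of_ne hj] at hij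
        exact h hij
  | node v ch ih =>
    obtain ⟨k, hk⟩ := mem_faces_node.1 hF
    rw [h.subdivide_node hk]
    rw [mem_verts_node, not_or, not_exists] at hn
    obtain ⟨hx, hxv, hv, hxc, hd, hp⟩ := h
    have hverts := (hp k).verts_subdivide hk n
    refine ⟨hx, hxv, ?_, ?_, ?_, ?_⟩
    · rw [Function.forall_update_iff ch (p := fun _ T => v ∉ T.verts), hverts]
      exact ⟨by simp [Ne.symm hn.1, hv k], fun l _ => hv l⟩
    · rw [Function.forall_update_iff ch (p := fun _ T => ∀ i, x i ∉ T.verts), hverts]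
      exact ⟨fun i => by simp [hxn i, hxc k i], fun l _ => hxc l⟩
    · intro l m hlm
      by_cases hl : l = k
      · subst hl
        rw [Function.update_self, Function.update_of_ne hlm.symm, hverts,
          Finset.disjoint_insert_left]
        exact ⟨hn.2 m, hd _ _ hlm⟩
      · rw [Function.update_of_ne hl]
        by_cases hm : m = k
        · subst hm
          rw [Function.update_self, hverts, Finset.disjoint_insert_right]
          exact ⟨hn.2 l, hd _ _ hlm⟩
        · rw [Function.update_of_ne hm]
          exact hd _ _ hlm
    · rw [Function.forall_update_iff ch (p := fun l T => T.Proper (Function.update x l v))]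
      refine ⟨ih k (hp k) hk (hn.2 k) fun i hi => ?_, fun l _ => hp l⟩
      rcases exists_update_eq.1 ⟨i, hi⟩ with h | ⟨j, -, h⟩
      · exact hn.1 h.symm
      · exact hxn j h

theorem Proper.faces_subdivide {T : LabelledTree} {x : Fin 3 → ℕ} (h : T.Proper x)
    {F : Finset ℕ} (hF : F ∈ T.faces x) {n : ℕ} :
    (T.subdivide x F n).faces x =
      (T.faces x).erase F ∪ F.image fun y => insert n (F.erase y) := by
  induction T generalizing x with
  | leaf =>
    rw [faces, Finset.mem_singleton] at hF
    rw [LabelledTree.subdivide, if_pos hF]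
    ext G
    rw [mem_faces_node]
    subst hF
    simp only [faces, Finset.mem_singleton, Finset.erase_singleton, Finset.empty_union,
      Finset.mem_image, Finset.mem_univ, true_and, exists_exists_eq_and]
    have : ∀ k, Finset.univ.image (Function.update x k n) =
        insert n ((Finset.univ.image x).erase (x k)) := by
      intro k
      ext w
      simp only [Finset.mem_image, Finset.mem_univ, true_and, Finset.mem_insert, Finset.mem_erase]
      rw [exists_update_eq]
      constructor
      · rintro (rfl | ⟨i, hi, rfl⟩)
        · exact .inl rfl
        · exact .inr ⟨fun h' => hi (h h'), i, rfl⟩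
      · rintro (rfl | ⟨hw, i, rfl⟩)
        · exact .inl rfl
        · exact .inr ⟨i, fun h' => hw (by rw [h']), rfl⟩
    simp only [this, eq_comm]
  | node v ch ih =>
    obtain ⟨k, hk⟩ := mem_faces_node.1 hF
    rw [h.subdivide_node hk]
    ext G
    rw [mem_faces_node,
      Function.exists_update_iff ch (p := fun l T => G ∈ T.faces (Function.update x l v)),
      ih k (h.2.2.2.2.2 k) hk, Finset.mem_union, Finset.mem_union, Finset.mem_erase,
      Finset.mem_erase, mem_faces_node]
    constructor
    · rintro ((⟨hG, h'⟩ | h') | ⟨l, hl, h'⟩)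
      · exact .inl ⟨hG, k, h'⟩
      · exact .inr h'
      · refine .inl ⟨?_, l, h'⟩
        rintro rfl
        exact hl (h.eq_of_mem_faces h' hk)
    · rintro (⟨hG, l, h'⟩ | h')
      · by_cases hl : l = k
        · subst hl
          exact .inl (.inl ⟨hG, h'⟩)
        · exact .inr ⟨l, hl, h'⟩
      · exact .inl (.inr h')

theorem Separated.mono {E E' : ℕ → ℕ → Prop} {T : LabelledTree} {x : Fin 3 → ℕ}
    (h : T.Separated E x) (hE : ∀ u ∈ T.verts, ∀ w, E' u w → E u w) : T.Separated E' x := by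
  induction T generalizing x with
  | leaf => trivial
  | node v ch ih =>
    have hk : ∀ k, ∀ u ∈ (ch k).verts, ∀ w, E' u w → E u w := fun k u hu =>
      hE u (mem_verts_node.2 (.inr ⟨k, hu⟩))
    exact fun k => ⟨fun u hu w huw => (h k).1 u hu w (hk k u hu w huw), ih k (h k).2 (hk k)⟩

/-- The new vertex is joined only to corners of `F`, and these lie in the interior or among the
corners of the part containing `F`. None of them is interior to another part, so no edge is added at
the interior vertices of the other parts. -/
theorem Separated.subdivide {E E' : ℕ → ℕ → Prop} {T : LabelledTree} {x : Fin 3 → ℕ}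
    (h : T.Separated E x) (hp : T.Proper x) {F : Finset ℕ} (hF : F ∈ T.faces x) {n : ℕ}
    (hn : n ∉ T.verts) (hEn : ∀ w, ¬ E n w)
    (hE : ∀ u w, E' u w → E u w ∨ (u = n ∧ w ∈ F) ∨ (w = n ∧ u ∈ F)) :
    (T.subdivide x F n).Separated E' x := by
  induction T generalizing x with
  | leaf =>
    rw [faces, Finset.mem_singleton] at hF
    rw [LabelledTree.subdivide, if_pos hF]
    exact fun k => ⟨by simp [verts], trivial⟩
  | node v ch ih =>
    obtain ⟨k, hk⟩ := mem_faces_node.1 hF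
    rw [hp.subdivide_node hk]
    rw [mem_verts_node, not_or, not_exists] at hn
    obtain ⟨hx, hxv, hv, hxc, hd, hp⟩ := hp
    have hverts := (hp k).verts_subdivide hk n
    intro l
    by_cases hl : l = k
    · subst hl
      rw [Function.update_self, hverts]
      refine ⟨fun u hu w huw => ?_, ih l (h l).2 (hp l) hk (hn.2 l)⟩
      rw [Finset.mem_insert, or_assoc]
      rcases Finset.mem_insert.1 hu with rfl | hu
      · rcases hE u w huw with h' | ⟨-, h'⟩ | ⟨h', -⟩
        · exact absurd h' (hEn w)
        · exact .inr (mem_or_exists_of_mem_faces hk h')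
        · exact .inl h'
      · rcases hE u w huw with h' | ⟨h', -⟩ | ⟨h', -⟩
        · exact .inr ((h l).1 u hu w h')
        · exact absurd (h' ▸ hu) (hn.2 l)
        · exact .inl h'
    · rw [Function.update_of_ne hl]
      have hE' : ∀ u ∈ (ch l).verts, ∀ w, E' u w → E u w := by
        intro u hu w huw
        rcases hE u w huw with h' | ⟨h', -⟩ | ⟨-, h'⟩
        · exact h'
        · exact absurd (h' ▸ hu) (hn.2 l)
        · rcases mem_or_exists_of_mem_faces hk h' with h' | h'
          · exact absurd h' (Finset.disjoint_left.1 (hd l k hl) hu)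
          · rcases exists_update_eq.1 h' with rfl | ⟨i, -, rfl⟩
            · exact absurd hu (hv l)
            · exact absurd hu (hxc l i)
      exact ⟨fun u hu w huw => (h l).1 u hu w (hE' u hu w huw), (h l).2.mono hE'⟩

/-- Faces correspond to leaves, so a uniform choice of a face induces a uniform growth step of the
shape. Taking `g = 1` counts the faces. -/
theorem Proper.sum_faces_shape_subdivide {T : LabelledTree} {x : Fin 3 → ℕ} (h : T.Proper x)
    (n : ℕ) (g : TernTree → ℝ) :
    ∑ F ∈ T.faces x, g (T.subdivide x F n).shape = TernTree.growSum g T.shape := by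
  induction T generalizing x g with
  | leaf =>
    simp [faces, LabelledTree.subdivide, shape, TernTree.growSum_leaf]
  | node v ch ih =>
    have hp := h.2.2.2.2.2
    rw [faces, Finset.sum_biUnion, Fin.sum_univ_three, shape, TernTree.growSum_node]
    · refine congrArg₂ _ (congrArg₂ _ ?_ ?_) ?_
      · rw [← ih 0 (hp 0)]
        refine Finset.sum_congr rfl fun F hF => ?_
        rw [h.subdivide_node hF]
        simp [shape]
      · rw [← ih 1 (hp 1)]
        refine Finset.sum_congr rfl fun F hF => ?_
        rw [h.subdivide_node hF]
        simp [shape]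
      · rw [← ih 2 (hp 2)]
        refine Finset.sum_congr rfl fun F hF => ?_
        rw [h.subdivide_node hF]
        simp [shape]
    · intro k _ l _ hkl
      exact Finset.disjoint_left.2 fun F hk hl => hkl (h.eq_of_mem_faces hk hl)

theorem Proper.card_faces {T : LabelledTree} {x : Fin 3 → ℕ} (h : T.Proper x) :
    (T.faces x).card = 2 * T.shape.size + 1 := by
  have h1 := h.sum_faces_shape_subdivide 0 fun _ => 1
  simp only [Finset.sum_const, nsmul_eq_mul, mul_one, TernTree.growSum_apply, List.map_const',
    List.sum_replicate, TernTree.length_grow] at h1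
  exact_mod_cast h1

theorem Proper.size_shape_subdivide {T : LabelledTree} {x : Fin 3 → ℕ} (h : T.Proper x)
    {F : Finset ℕ} (hF : F ∈ T.faces x) (n : ℕ) :
    (T.subdivide x F n).shape.size = T.shape.size + 1 := by
  induction T generalizing x with
  | leaf =>
    rw [faces, Finset.mem_singleton] at hF
    rw [LabelledTree.subdivide, if_pos hF]
    rfl
  | node v ch ih =>
    obtain ⟨k, hk⟩ := mem_faces_node.1 hF
    have := ih k (h.2.2.2.2.2 k) hk
    rw [h.subdivide_node hk]
    fin_cases k <;> simp [shape, TernTree.size] at this ⊢ <;> omega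

end LabelledTree

/-! ### Paths and the avoided grandchild. -/

/-- A walk that changes colour only at the vertices of `S` has at most one colour more than there
are visits to `S`. -/
theorem card_image_filter_le_of_isChain {α β : Type*} [DecidableEq α]
    [DecidableEq β] (S : Finset α) (c : α → β) (l : List α)
    (hl : l.IsChain fun u w => u ∈ S ∨ w ∈ S ∨ c u = c w) :
    ((l.filter (· ∉ S)).toFinset.image c).card ≤
      (l.filter (· ∈ S)).length + if ∃ u ∈ l.head?, u ∈ S then 0 else 1 := by
  -- The correction term for the head makes the induction work: the first stretch outside `S` is the
  -- only one not preceded by a visit to `S`.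
  induction l with
  | nil => simp
  | cons u l ih =>
    have ih := ih hl.tail
    by_cases hu : u ∈ S
    · have h1 : ((u :: l).filter (· ∉ S)) = l.filter (· ∉ S) := by
        rw [List.filter_cons]; simp [hu]
      have h2 : ((u :: l).filter (· ∈ S)) = u :: l.filter (· ∈ S) := by
        rw [List.filter_cons]; simp [hu]
      rw [h1, h2, List.length_cons]
      split_ifs at ih <;> omega
    · cases l with
      | nil => simp [hu]
      | cons w l =>
        have huw := (List.isChain_cons_cons.1 hl).1
        by_cases hw : w ∈ S
        · have h1 : ((u :: w :: l).filter (· ∉ S)) = u :: ((w :: l).filter (· ∉ S)) := by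
            rw [List.filter_cons]; simp [hu]
          have h2 : ((u :: w :: l).filter (· ∈ S)) = ((w :: l).filter (· ∈ S)) := by
            rw [List.filter_cons]; simp [hu]
          rw [h1, h2, List.toFinset_cons, Finset.image_insert]
          have h3 := Finset.card_insert_le (c u) (((w :: l).filter (· ∉ S)).toFinset.image c)
          simp only [List.head?_cons, Option.mem_def, Option.some.injEq, exists_eq_left', hu, hw,
            if_true, if_false] at ih ⊢
          omega
        · have hc : c u = c w := by tauto
          have h1 : ((u :: w :: l).filter (· ∉ S)) = u :: ((w :: l).filter (· ∉ S)) := by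
            rw [List.filter_cons]; simp [hu]
          have h2 : ((u :: w :: l).filter (· ∈ S)) = ((w :: l).filter (· ∈ S)) := by
            rw [List.filter_cons]; simp [hu]
          rw [h1, h2, List.toFinset_cons, Finset.image_insert, Finset.insert_eq_of_mem]
          · simp only [List.head?_cons, Option.mem_def, Option.some.injEq, exists_eq_left', hu, hw,
              if_false] at ih ⊢
            exact ih
          · rw [hc]
            apply Finset.mem_image_of_mem
            simp [hw]

namespace LabelledTree

variable {E : ℕ → ℕ → Prop} {P : List ℕ}

/-- A path avoids one of the nine triangles obtained by subdividing a triangle twice. -/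
theorem exists_disjoint_verts {v : ℕ} {v' : Fin 3 → ℕ} {g : Fin 3 → Fin 3 → LabelledTree}
    {x : Fin 3 → ℕ} (hE : ∀ u w, E u w → E w u)
    (hp : (node v fun k => node (v' k) (g k)).Proper x)
    (hs : (node v fun k => node (v' k) (g k)).Separated E x) (hP : P.IsChain E)
    (hnd : P.Nodup) : ∃ k l, ∀ u ∈ P, u ∉ (g k l).verts := by
  classical
  by_contra! hcon
  choose u hu hug using hcon
  obtain ⟨-, -, hv, hxc, hd, hp⟩ := hp
  -- The at most seven separating vertices: the corners, the centre and the centres of the three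
  -- parts.
  set S : Finset ℕ := Finset.univ.image x ∪ insert v (Finset.univ.image v') with hS
  have hScard : S.card ≤ 7 := by
    have h1 := Finset.card_union_le (Finset.univ.image x) (insert v (Finset.univ.image v'))
    have h2 := Finset.card_image_le (s := Finset.univ) (f := x)
    have h3 := Finset.card_insert_le v (Finset.univ.image v')
    have h4 := Finset.card_image_le (s := Finset.univ) (f := v')
    simp only [Finset.card_univ, Fintype.card_fin] at h2 h4
    rw [hS]
    omega
  have hsub : ∀ k l w, w ∈ (g k l).verts → w ∈ (node (v' k) (g k)).verts := fun k l w hw =>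
    mem_verts_node.2 (.inr ⟨l, hw⟩)
  have hnS : ∀ k l w, w ∈ (g k l).verts → w ∉ S := by
    intro k l w hw hwS
    simp only [hS, Finset.mem_union, Finset.mem_insert, Finset.mem_image, Finset.mem_univ,
      true_and] at hwS
    have hw' := hsub k l w hw
    rcases hwS with ⟨i, rfl⟩ | rfl | ⟨k', rfl⟩
    · exact hxc k i hw'
    · exact hv k hw'
    · by_cases hk : k' = k
      · subst hk
        exact (hp k').2.2.1 l hw
      · exact Finset.disjoint_left.1 (hd k' k hk) (mem_verts_node.2 (.inl rfl)) hw'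
  have hstep : ∀ k l a b, a ∈ (g k l).verts → E a b → b ∉ S → b ∈ (g k l).verts := by
    intro k l a b ha hab hb
    simp only [hS, Finset.mem_union, Finset.mem_insert, Finset.mem_image, Finset.mem_univ,
      true_and, not_or] at hb
    rcases ((hs k).2 l).1 a ha b hab with h | h
    · exact h
    · rcases exists_update_eq.1 h with h | ⟨i, -, h⟩
      · exact absurd ⟨k, h⟩ hb.2.2
      · rcases exists_update_eq.1 ⟨i, h⟩ with h | ⟨j, -, h⟩
        · exact absurd h.symm hb.2.1
        · exact absurd ⟨j, h⟩ hb.1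
  -- The colour of a vertex is the set of regions containing it. It is constant along edges outside
  -- `S`, and vertices in no region harmlessly share the colour `∅`.
  set c : ℕ → Set (Fin 3 × Fin 3) := fun w => {kl | w ∈ (g kl.1 kl.2).verts} with hc
  have hchain : P.IsChain fun a b => a ∈ S ∨ b ∈ S ∨ c a = c b := by
    refine hP.imp fun a b hab => ?_
    by_cases ha : a ∈ S
    · exact .inl ha
    by_cases hb : b ∈ S
    · exact .inr (.inl hb)
    · refine .inr (.inr (Set.ext fun kl => ⟨fun h => ?_, fun h => ?_⟩))
      · exact hstep _ _ a b h hab hb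
      · exact hstep _ _ b a h (hE a b hab) ha
  have h1 := card_image_filter_le_of_isChain S c P hchain
  have h2 : (P.filter (· ∈ S)).length ≤ S.card := by
    rw [← List.toFinset_card_of_nodup (hnd.filter _)]
    refine Finset.card_le_card fun a ha => ?_
    simpa using (List.mem_filter.1 (List.mem_toFinset.1 ha)).2
  have h3 : (Finset.univ : Finset (Fin 3 × Fin 3)).card ≤
      ((P.filter (· ∉ S)).toFinset.image c).card := by
    refine Finset.card_le_card_of_injOn (fun kl => c (u kl.1 kl.2)) ?_ ?_
    · intro kl _
      refine Finset.mem_coe.2 (Finset.mem_image_of_mem _ ?_)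
      rw [List.mem_toFinset, List.mem_filter]
      exact ⟨hu _ _, by simpa using hnS _ _ _ (hug kl.1 kl.2)⟩
    · rintro ⟨k, l⟩ - ⟨k', l'⟩ - h
      have hmem : u k l ∈ (g k' l').verts := by
        have : (k', l') ∈ c (u k' l') := hug k' l'
        simp only at h
        rw [← h] at this
        exact this
      by_cases hk : k = k'
      · subst hk
        by_cases hl : l = l'
        · rw [hl]
        · exact absurd hmem (Finset.disjoint_left.1 ((hp k).2.2.2.2.1 l l' hl) (hug k l))
      · exact absurd (hsub _ _ _ hmem)
          (Finset.disjoint_left.1 (hd k k' hk) (hsub _ _ _ (hug k l)))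
  have h4 : (Finset.univ : Finset (Fin 3 × Fin 3)).card = 9 := rfl
  -- Nine colours would occur, but at most `7 + 1` are possible.
  split_ifs at h1 <;> omega

/-- The number of interior vertices that belong to `P`. -/
def visits (P : List ℕ) (T : LabelledTree) : ℕ := (T.verts.filter (· ∈ P)).card

theorem visits_leaf : visits P leaf = 0 := by simp [visits, verts]

theorem visits_node_le (v : ℕ) (ch : Fin 3 → LabelledTree) :
    visits P (node v ch) ≤ 1 + visits P (ch 0) + visits P (ch 1) + visits P (ch 2) := by
  have hsub : (node v ch).verts.filter (· ∈ P) ⊆ insert v ((ch 0).verts.filter (· ∈ P) ∪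
      (ch 1).verts.filter (· ∈ P) ∪ (ch 2).verts.filter (· ∈ P)) := by
    intro w
    simp only [Finset.mem_filter, mem_verts_node, Fin.exists_fin_succ, Finset.mem_insert,
      Finset.mem_union, Fin.succ_zero_eq_one, Fin.succ_one_eq_two]
    simp only [IsEmpty.exists_iff]
    tauto
  have h1 := Finset.card_le_card hsub
  have h2 := Finset.card_insert_le v ((ch 0).verts.filter (· ∈ P) ∪
      (ch 1).verts.filter (· ∈ P) ∪ (ch 2).verts.filter (· ∈ P))
  have h3 := Finset.card_union_le ((ch 0).verts.filter (· ∈ P) ∪ (ch 1).verts.filter (· ∈ P))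
    ((ch 2).verts.filter (· ∈ P))
  have h4 := Finset.card_union_le ((ch 0).verts.filter (· ∈ P)) ((ch 1).verts.filter (· ∈ P))
  simp only [visits]
  omega

theorem visits_eq_zero {T : LabelledTree} (h : ∀ u ∈ P, u ∉ T.verts) : visits P T = 0 := by
  rw [visits, Finset.card_eq_zero, Finset.filter_eq_empty_iff]
  exact fun u hu hP => h u hP hu

theorem visits_lt_avoidChildBound {v : ℕ} {ch : Fin 3 → LabelledTree} {l : Fin 3}
    (h : ∀ k, visits P (ch k) < (ch k).shape.avoidBound) (hl : ∀ u ∈ P, u ∉ (ch l).verts) :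
    visits P (node v ch) < (node v ch).shape.avoidChildBound := by
  have h0 := visits_eq_zero hl
  have h1 := visits_node_le (P := P) v ch
  have i0 := h 0
  have i1 := h 1
  have i2 := h 2
  rw [shape, TernTree.avoidChildBound_node]
  fin_cases l <;> simp at h0 <;> omega

/-- The number of interior vertices on a path is bounded in terms of the shape. -/
theorem visits_lt_avoidBound (hE : ∀ u w, E u w → E w u) (hP : P.IsChain E) (hnd : P.Nodup)
    {T : LabelledTree} {x : Fin 3 → ℕ} (hp : T.Proper x) (hs : T.Separated E x) :
    visits P T < T.shape.avoidBound := by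
  -- The statement is strengthened to include the children: when a grandchild is avoided, the bound
  -- is also needed for the other grandchildren in the same child, two levels below the current
  -- node.
  suffices visits P T < T.shape.avoidBound ∧ ∀ v ch, T = node v ch →
      ∀ k, visits P (ch k) < (ch k).shape.avoidBound from this.1
  induction T generalizing x with
  | leaf =>
    refine ⟨?_, fun v ch h => by cases h⟩
    rw [visits_leaf, shape, TernTree.avoidBound_leaf]
    exact one_pos
  | node v ch ih =>
    have ih := fun k => ih k (hp.2.2.2.2.2 k) (hs k).2
    refine ⟨?_, fun v' ch' h => by cases h; exact fun k => (ih k).1⟩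
    have hex : ∃ k, visits P (ch k) < (ch k).shape.avoidChildBound := by
      -- A child that is a leaf has no interior vertices, and `avoidChildBound leaf = 1` already
      -- gives the strict inequality for it. So the nine-region argument is needed only when all
      -- three children are internal.
      by_cases hleaf : ∃ k, ch k = leaf
      · obtain ⟨k, hk⟩ := hleaf
        refine ⟨k, ?_⟩
        rw [hk, visits_leaf, shape, TernTree.avoidChildBound_leaf]
        exact one_pos
      · have hnode : ∀ k, ∃ w g, ch k = node w g := by
          intro k
          cases hk : ch k with
          | leaf => exact absurd ⟨k, hk⟩ hleaf
          | node w g => exact ⟨w, g, rfl⟩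
        choose v' g hg using hnode
        obtain rfl : ch = fun k => node (v' k) (g k) := funext hg
        obtain ⟨k, l, hkl⟩ := exists_disjoint_verts hE hp hs hP hnd
        exact ⟨k, visits_lt_avoidChildBound ((ih k).2 _ _ rfl) hkl⟩
    obtain ⟨k, hk⟩ := hex
    have h1 := visits_node_le (P := P) v ch
    have i0 := (ih 0).1
    have i1 := (ih 1).1
    have i2 := (ih 2).1
    rw [shape, TernTree.avoidBound_node]
    fin_cases k <;> simp at hk <;> omega

/-! ### Networks represented by labelled trees. -/

/-- The corners of the outer triangle. -/
def outer : Fin 3 → ℕ := Fin.val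

/-- The tree `T` describes the successive subdivisions that lead to `G`. -/
structure Represents (T : LabelledTree) (G : Apollonian) : Prop where
  order_eq : G.order = T.shape.size + 3
  faces_eq : G.faces = T.faces outer
  proper : T.Proper outer
  separated : T.Separated (fun u w => s(u, w) ∈ G.edges) outer
  verts_eq : T.verts = Finset.Ico 3 G.order
  lt_order : ∀ u w, s(u, w) ∈ G.edges → u < G.order

theorem represents_triangle : leaf.Represents Apollonian.triangle where
  order_eq := rfl
  faces_eq := rfl
  proper := Fin.val_injective
  separated := trivial
  verts_eq := rfl
  lt_order u w h := by
    simp only [Apollonian.triangle, Finset.mem_insert, Finset.mem_singleton, Sym2.eq_iff] at h ⊢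
    omega

theorem outer_lt (i : Fin 3) : outer i < 3 := i.2

theorem Represents.lt_order_of_mem_faces {T : LabelledTree} {G : Apollonian} (h : T.Represents G)
    {F : Finset ℕ} (hF : F ∈ G.faces) {w : ℕ} (hw : w ∈ F) : w < G.order := by
  rw [h.faces_eq] at hF
  rcases mem_or_exists_of_mem_faces hF hw with h' | ⟨i, rfl⟩
  · rw [h.verts_eq] at h'
    exact (Finset.mem_Ico.1 h').2
  · have := outer_lt i
    have := h.order_eq
    omega

theorem Represents.subdivide {T : LabelledTree} {G : Apollonian} (h : T.Represents G)
    {F : Finset ℕ} (hF : F ∈ G.faces) :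
    (T.subdivide outer F G.order).Represents (G.subdivide F) := by
  have hF' : F ∈ T.faces outer := h.faces_eq ▸ hF
  have hn : G.order ∉ T.verts := by simp [h.verts_eq]
  have hG := h.order_eq
  refine ⟨?_, ?_, ?_, ?_, ?_, ?_⟩
  · rw [h.proper.size_shape_subdivide hF']
    simp only [Apollonian.subdivide]
    omega
  · rw [h.proper.faces_subdivide hF']
    simp only [Apollonian.subdivide, h.faces_eq]
  · refine h.proper.subdivide hF' hn fun i => ?_
    have := outer_lt i
    omega
  -- `lt_order` ensures that the new vertex `G.order` has no edges in `G`.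
  · refine h.separated.subdivide h.proper hF' hn (fun w hw => (h.lt_order _ _ hw).false) ?_
    intro u w huw
    simp only [Apollonian.subdivide, Finset.mem_union, Finset.mem_image, Sym2.eq_iff] at huw
    rcases huw with h' | ⟨y, hy, ⟨rfl, rfl⟩ | ⟨rfl, rfl⟩⟩
    · exact .inl h'
    · exact .inr (.inr ⟨rfl, hy⟩)
    · exact .inr (.inl ⟨rfl, hy⟩)
  · rw [h.proper.verts_subdivide hF', h.verts_eq]
    ext w
    simp only [Apollonian.subdivide, Finset.mem_insert, Finset.mem_Ico]
    omega
  · intro u w huw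
    simp only [Apollonian.subdivide, Finset.mem_union, Finset.mem_image, Sym2.eq_iff] at huw ⊢
    rcases huw with h' | ⟨y, hy, ⟨rfl, rfl⟩ | ⟨rfl, rfl⟩⟩
    · have := h.lt_order u w h'
      omega
    · have := h.lt_order_of_mem_faces hF hy
      omega
    · omega

theorem Represents.card_faces {T : LabelledTree} {G : Apollonian} (h : T.Represents G) :
    G.faces.card = 2 * T.shape.size + 1 := by
  rw [h.faces_eq, h.proper.card_faces]

/-- A face survives the subdivision of any other face but not its own: each new face contains the
new vertex. This makes the events of subdividing different faces disjoint. -/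
theorem Represents.subdivide_injOn {T : LabelledTree} {G : Apollonian} (h : T.Represents G) :
    Set.InjOn G.subdivide G.faces := by
  intro F hF F' hF' hFF
  by_contra hne
  have h1 : F ∈ (G.subdivide F').faces :=
    Finset.mem_union_left _ (Finset.mem_erase.2 ⟨hne, hF⟩)
  rw [← hFF] at h1
  rcases Finset.mem_union.1 h1 with h1 | h1
  · exact (Finset.mem_erase.1 h1).1 rfl
  · obtain ⟨y, -, hy⟩ := Finset.mem_image.1 h1
    have : G.order ∈ F := hy ▸ Finset.mem_insert_self _ _
    exact (h.lt_order_of_mem_faces hF this).false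

theorem Represents.longestPathOrder_le {T : LabelledTree} {G : Apollonian} (h : T.Represents G) :
    longestPathOrder G.graph ≤ 3 * T.shape.avoidBound := by
  have hne : Nonempty (Fin G.order) := ⟨⟨0, by have := h.order_eq; omega⟩⟩
  obtain ⟨u, v, p, hp, hlen⟩ := (isGreatest_longestPathOrder G.graph).1
  rw [← hlen]
  set P := p.support.map Fin.val with hPdef
  have hnd : P.Nodup := hp.support_nodup.map Fin.val_injective
  have hchain : P.IsChain fun u w => s(u, w) ∈ G.edges := by
    rw [hPdef, List.isChain_map]
    refine p.isChain_adj_support.imp fun a b hab => ?_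
    simp only [Apollonian.graph, SimpleGraph.comap_adj, SimpleGraph.fromEdgeSet_adj,
      Finset.mem_coe] at hab
    exact hab.1
  have hvis := visits_lt_avoidBound (fun u w huw => by rwa [Sym2.eq_swap]) hchain hnd
    h.proper h.separated
  have hsub : P.toFinset ⊆ Finset.range 3 ∪ T.verts.filter (· ∈ P) := by
    intro w hw
    rw [List.mem_toFinset] at hw
    obtain ⟨a, -, rfl⟩ := List.mem_map.1 hw
    rw [Finset.mem_union, Finset.mem_filter, h.verts_eq, Finset.mem_range, Finset.mem_Ico]
    have := a.2
    by_cases h3 : (a : ℕ) < 3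
    · exact .inl h3
    · exact .inr ⟨⟨by omega, this⟩, hw⟩
  have h1 := (Finset.card_le_card hsub).trans (Finset.card_union_le _ _)
  rw [List.toFinset_card_of_nodup hnd, hPdef, List.length_map, ← hPdef, Finset.card_range] at h1
  change _ ≤ 3 + visits P T at h1
  -- The path has at most `3 + visits P T ≤ avoidBound + 2` vertices, and `avoidBound ≥ 1` because
  -- it exceeds `visits`.
  omega

end LabelledTree

/-! ### The random process and its comparison with random trees. -/

namespace Apollonian

instance : Countable Apollonian :=
  Function.Injective.countable (f := fun G : Apollonian => (G.order, G.edges, G.faces))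
    fun G H h => by
      simp only [Prod.mk.injEq] at h
      exact Apollonian.ext h.1 h.2.1 h.2.2

/-- The expected value of a function after a random subdivision. -/
noncomputable def subdivideMean (f : Apollonian → ENNReal) (G : Apollonian) : ENNReal :=
  (∑ F ∈ G.faces, f (G.subdivide F)) / G.faces.card

/-- The networks that arise from a triangle by `t` subdivisions. -/
def IsNetwork (t : ℕ) (G : Apollonian) : Prop :=
  ∃ T : LabelledTree, T.Represents G ∧ T.shape.size = t

theorem IsNetwork.card_faces_ne_zero {t : ℕ} {G : Apollonian} (h : G.IsNetwork t) :
    G.faces.card ≠ 0 := by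
  obtain ⟨T, hT, -⟩ := h
  rw [hT.card_faces]
  omega

theorem IsNetwork.subdivide {t : ℕ} {G : Apollonian} (h : G.IsNetwork t) {F : Finset ℕ}
    (hF : F ∈ G.faces) : (G.subdivide F).IsNetwork (t + 1) := by
  obtain ⟨T, hT, rfl⟩ := h
  exact ⟨_, hT.subdivide hF, hT.proper.size_shape_subdivide (hT.faces_eq ▸ hF) _⟩

theorem IsNetwork.pairwiseDisjoint {Ω : Type*} {n : ℕ} {G : Apollonian}
    (hG : G.IsNetwork n) (R : ℕ → Ω → Apollonian) (t : ℕ) : Set.PairwiseDisjoint (G.faces : Set (Finset ℕ))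
      fun F => {ω | R t ω = G ∧ R (t + 1) ω = G.subdivide F} := by
  obtain ⟨T, hT, -⟩ := hG
  intro F hF F' hF' hne
  exact Set.disjoint_left.2 fun ω h1 h2 =>
    hne (hT.subdivide_injOn hF hF' (h1.2.symm.trans h2.2))

end Apollonian

namespace IsRandomApollonianNetwork

variable {Ω : Type*} [MeasurableSpace Ω] {μ : Measure Ω} {R : ℕ → Ω → Apollonian}

theorem measurableSet_eq (h : IsRandomApollonianNetwork μ R) (t : ℕ) (G : Apollonian) :
    MeasurableSet {ω | R t ω = G} := h.measurable t (MeasurableSet.of_discrete (s := {G}))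

/-- The step rule is conditional on whole histories. There are countably many of these, so summing
over the histories that end in `G` gives the rule conditional on the present state only. -/
theorem measure_eq_and_eq_subdivide (h : IsRandomApollonianNetwork μ R) (t : ℕ) {G : Apollonian}
    {F : Finset ℕ} (hF : F ∈ G.faces) :
    μ {ω | R t ω = G ∧ R (t + 1) ω = G.subdivide F} = μ {ω | R t ω = G} / G.faces.card := by
  set s : (Fin t → Apollonian) → ℕ → Apollonian :=
    fun σ i => if hi : i < t then σ ⟨i, hi⟩ else G with hs
  have hst : ∀ σ, s σ t = G := fun σ => by simp [hs]
  have hiff : ∀ σ ω, (∀ i ≤ t, R i ω = s σ i) ↔ R t ω = G ∧ (fun i : Fin t => R i ω) = σ := by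
    intro σ ω
    constructor
    · intro hω
      refine ⟨by rw [hω t le_rfl, hst], funext fun i => ?_⟩
      rw [hω i i.2.le]
      simp [hs]
    · rintro ⟨h1, rfl⟩ i hi
      by_cases hit : i < t
      · simp [hs, hit]
      · obtain rfl : i = t := by omega
        simp [hs, h1]
  have hmeas : ∀ σ : Fin t → Apollonian, MeasurableSet {ω | (fun i : Fin t => R i ω) = σ} := by
    intro σ
    have : {ω | (fun i : Fin t => R i ω) = σ} = ⋂ i : Fin t, {ω | R i ω = σ i} := by
      ext ω; simp [funext_iff]
    rw [this]
    exact MeasurableSet.iInter fun i => h.measurableSet_eq _ _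
  have hsum : ∀ B : Set Ω, MeasurableSet B →
      μ B = ∑' σ : Fin t → Apollonian, μ (B ∩ {ω | (fun i : Fin t => R i ω) = σ}) := by
    intro B hB
    rw [← measure_iUnion]
    · congr 1
      ext ω
      simp
    · intro σ τ hστ
      refine Set.disjoint_left.2 fun ω h1 h2 => hστ (h1.2.symm.trans h2.2)
    · exact fun σ => hB.inter (hmeas σ)
  have hB := (h.measurableSet_eq t G).inter (h.measurableSet_eq (t + 1) (G.subdivide F))
  rw [show {ω | R t ω = G ∧ R (t + 1) ω = G.subdivide F} =
    {ω | R t ω = G} ∩ {ω | R (t + 1) ω = G.subdivide F} from rfl, hsum _ hB,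
    hsum _ (h.measurableSet_eq t G), div_eq_mul_inv, ← ENNReal.tsum_mul_right]
  refine tsum_congr fun σ => ?_
  have h1 := h.step t (s σ) F (by rw [hst]; exact hF)
  rw [hst, div_eq_mul_inv] at h1
  refine Eq.trans (congrArg μ ?_) (h1.trans (congrArg (fun B => μ B * _) ?_))
  · ext ω
    simp only [Set.mem_inter_iff, Set.mem_ofPred_eq, hiff]
    tauto
  · ext ω
    simp only [Set.mem_inter_iff, Set.mem_ofPred_eq, hiff]

theorem measurableSet_eq_and_eq (h : IsRandomApollonianNetwork μ R) (t : ℕ) (G H : Apollonian) :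
    MeasurableSet {ω | R t ω = G ∧ R (t + 1) ω = H} :=
  (h.measurableSet_eq t G).inter (h.measurableSet_eq (t + 1) H)

/-- The disjoint events of subdividing the individual faces have total measure `μ {ω | R t ω = G}`,
so outside them only a null set of this event remains. -/
theorem ae_exists_subdivide [IsFiniteMeasure μ] (h : IsRandomApollonianNetwork μ R) {t : ℕ}
    {n : ℕ} {G : Apollonian} (hG : G.IsNetwork n) :
    ∀ᵐ ω ∂μ, R t ω = G → ∃ F ∈ G.faces, R (t + 1) ω = G.subdivide F := by
  set B : Set Ω := ⋃ F ∈ G.faces, {ω | R t ω = G ∧ R (t + 1) ω = G.subdivide F} with hB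
  have hBG : B ⊆ {ω | R t ω = G} := by
    intro ω hω
    simp only [hB, Set.mem_iUnion] at hω
    obtain ⟨F, _, hω⟩ := hω
    exact hω.1
  have hμ : μ B = μ {ω | R t ω = G} := by
    rw [hB, measure_biUnion_finset (hG.pairwiseDisjoint R t) fun F _ =>
        h.measurableSet_eq_and_eq t G _,
      Finset.sum_congr rfl fun F hF => h.measure_eq_and_eq_subdivide t hF, Finset.sum_const,
      nsmul_eq_mul]
    exact ENNReal.mul_div_cancel (by exact_mod_cast hG.card_faces_ne_zero)
      (ENNReal.natCast_ne_top _)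
  have hBm' : MeasurableSet B := Finset.measurableSet_biUnion _ fun F _ =>
    h.measurableSet_eq_and_eq t G _
  have h0 : μ ({ω | R t ω = G} \ B) = 0 := by
    rw [measure_sdiff hBG hBm'.nullMeasurableSet (measure_ne_top μ B), hμ, tsub_self]
  filter_upwards [measure_eq_zero_iff_ae_notMem.1 h0] with ω hω hωG
  by_contra hcon
  refine hω ⟨hωG, fun hωB => hcon ?_⟩
  simp only [hB, Set.mem_iUnion] at hωB
  obtain ⟨F, hF, hω⟩ := hωB
  exact ⟨F, hF, hω.2⟩

theorem ae_isNetwork [IsFiniteMeasure μ] (h : IsRandomApollonianNetwork μ R) (t : ℕ) :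
    ∀ᵐ ω ∂μ, (R t ω).IsNetwork t := by
  induction t with
  | zero =>
    filter_upwards [h.init] with ω hω
    rw [hω]
    exact ⟨_, LabelledTree.represents_triangle, rfl⟩
  | succ t ih =>
    have h1 : ∀ G : Apollonian, ∀ᵐ ω ∂μ, G.IsNetwork t → R t ω = G →
        ∃ F ∈ G.faces, R (t + 1) ω = G.subdivide F := by
      intro G
      by_cases hG : G.IsNetwork t
      · filter_upwards [h.ae_exists_subdivide (t := t) hG] with ω hω _ using hω
      · exact ae_of_all _ fun ω h' => absurd h' hG
    filter_upwards [ih, ae_all_iff.2 h1] with ω hω hω1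
    obtain ⟨F, hF, hω2⟩ := hω1 _ hω rfl
    rw [hω2]
    exact hω.subdivide hF

theorem lintegral_succ_le [IsFiniteMeasure μ] (h : IsRandomApollonianNetwork μ R) (t : ℕ)
    (f : Apollonian → ENNReal) :
    ∫⁻ ω, f (R (t + 1) ω) ∂μ ≤ ∫⁻ ω, Apollonian.subdivideMean f (R t ω) ∂μ := by
  have hpart : ∀ g : Ω → ENNReal, ∫⁻ ω, g ω ∂μ = ∑' G, ∫⁻ ω in {ω | R t ω = G}, g ω ∂μ := by
    intro g
    rw [← lintegral_iUnion (fun G => h.measurableSet_eq t G)]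
    · have : ⋃ G, {ω | R t ω = G} = Set.univ := by ext ω; simp
      rw [this, setLIntegral_univ]
    · intro G H hGH
      exact Set.disjoint_left.2 fun ω h1 h2 => hGH (h1.symm.trans h2)
  rw [hpart, hpart]
  refine ENNReal.tsum_le_tsum fun G => ?_
  by_cases hG : G.IsNetwork t
  · have h1 : ∫⁻ ω in {ω | R t ω = G}, Apollonian.subdivideMean f (R t ω) ∂μ =
        Apollonian.subdivideMean f G * μ {ω | R t ω = G} := by
      rw [← setLIntegral_const]
      exact setLIntegral_congr_fun (h.measurableSet_eq t G) fun ω hω => by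
        rw [show R t ω = G from hω]
    have h2 : ∫⁻ ω in {ω | R t ω = G}, f (R (t + 1) ω) ∂μ ≤
        ∫⁻ ω in ⋃ F ∈ G.faces, {ω | R t ω = G ∧ R (t + 1) ω = G.subdivide F},
          f (R (t + 1) ω) ∂μ := by
      refine lintegral_mono' (Measure.restrict_mono_ae ?_) le_rfl
      filter_upwards [h.ae_exists_subdivide (t := t) hG] with ω hω hωG
      obtain ⟨F, hF, hω⟩ := hω hωG
      exact Set.mem_biUnion hF ⟨hωG, hω⟩
    rw [h1]
    refine h2.trans ((lintegral_biUnion_finset (hG.pairwiseDisjoint R t)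
      (fun F _ => h.measurableSet_eq_and_eq t G _) _).trans_le (le_of_eq ?_))
    rw [Apollonian.subdivideMean, div_eq_mul_inv, mul_assoc, Finset.sum_mul]
    refine Finset.sum_congr rfl fun F hF => ?_
    rw [mul_comm _⁻¹, ← div_eq_mul_inv, ← h.measure_eq_and_eq_subdivide t hF, ← setLIntegral_const]
    refine setLIntegral_congr_fun (h.measurableSet_eq_and_eq t G _) fun ω hω => ?_
    rw [show R (t + 1) ω = G.subdivide F from hω.2]
  · have : μ {ω | R t ω = G} = 0 := by
      refine measure_mono_null ?_ (h.ae_isNetwork t)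
      intro ω hω hω'
      exact hG (hω ▸ hω')
    rw [Measure.restrict_eq_zero.2 this]
    simp

/-- The expected value of a function of the network is bounded by a mean value over trees. -/
theorem lintegral_le_mass_div_totalMass [IsProbabilityMeasure μ]
    (h : IsRandomApollonianNetwork μ R) (t : ℕ) {f : Apollonian → ENNReal} {g : TernTree → ℝ}
    (hg : ∀ T, 0 ≤ g T) (hfg : ∀ (T : LabelledTree) (G : Apollonian), T.Represents G →
      T.shape.size = t → f G ≤ ENNReal.ofReal (g T.shape)) :
    ∫⁻ ω, f (R t ω) ∂μ ≤ ENNReal.ofReal (TernTree.mass t g / TernTree.totalMass t) := by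
  induction t generalizing f g with
  | zero =>
    have h1 : ∫⁻ ω, f (R 0 ω) ∂μ = ∫⁻ _, f Apollonian.triangle ∂μ := by
      refine lintegral_congr_ae ?_
      filter_upwards [h.init] with ω hω
      rw [hω]
    rw [h1, lintegral_const, measure_univ, mul_one, TernTree.totalMass_zero, div_one]
    exact hfg .leaf _ LabelledTree.represents_triangle rfl
  | succ t ih =>
    refine (h.lintegral_succ_le t f).trans ?_
    have hpos : (0 : ℝ) < 2 * t + 1 := by positivity
    -- The last step is averaged out: `f` is replaced by its mean over faces and `g` by its mean
    -- over the `2 * t + 1` leaves.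
    have h1 := ih (f := Apollonian.subdivideMean f)
      (g := fun T => (2 * t + 1 : ℝ)⁻¹ * TernTree.growSum g T)
      (fun T => mul_nonneg (by positivity) (List.sum_nonneg fun y hy => by
        obtain ⟨T', _, rfl⟩ := List.mem_map.1 hy
        exact hg T')) ?_
    · refine h1.trans_eq (congrArg _ ?_)
      rw [TernTree.mass_const_mul, ← TernTree.mass_succ]
      have h2 := TernTree.totalMass_succ t
      have p0 := TernTree.totalMass_pos t
      have p1 := TernTree.totalMass_pos (t + 1)
      rw [div_eq_div_iff p0.ne' p1.ne', mul_assoc, inv_mul_eq_iff_eq_mul₀ hpos.ne']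
      linear_combination (TernTree.mass (t + 1) g) * h2
    · intro T G hT hsize
      have hcard : G.faces.card = 2 * t + 1 := by rw [hT.card_faces, hsize]
      rw [Apollonian.subdivideMean, hcard, ← hT.proper.sum_faces_shape_subdivide G.order g,
        ENNReal.ofReal_mul (by positivity), ENNReal.ofReal_inv_of_pos hpos,
        ENNReal.ofReal_sum_of_nonneg fun F _ => hg _, ← hT.faces_eq, div_eq_mul_inv, mul_comm]
      refine mul_le_mul' (le_of_eq ?_) (Finset.sum_le_sum fun F hF => ?_)
      · congr 1
        rw [show (2 * (t : ℝ) + 1) = ((2 * t + 1 : ℕ) : ℝ) by push_cast; ring,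
          ENNReal.ofReal_natCast]
      · refine hfg _ _ (hT.subdivide hF) ?_
        rw [hT.proper.size_shape_subdivide (hT.faces_eq ▸ hF), hsize]

end IsRandomApollonianNetwork

/-! ### Tail bound and Borel–Cantelli. -/

theorem IsRandomApollonianNetwork.exists_measure_le_longestPathOrder_le :
    ∃ δ : ℝ, δ < 1 ∧ ∃ C : ℝ, ∀ {Ω : Type*} [MeasurableSpace Ω] (μ : Measure Ω)
      [IsProbabilityMeasure μ] (R : ℕ → Ω → Apollonian), IsRandomApollonianNetwork μ R →
      ∀ t : ℕ, 0 < t → μ {ω | (t : ℝ) ^ δ ≤ longestPathOrder (R t ω).graph} ≤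
        ENNReal.ofReal (C * (1 / (t : ℝ) ^ 2)) := by
  obtain ⟨r, β, hβ⟩ := TernTree.exists_mass_avoidBound_pow_le
  have hβ0 : 0 ≤ β := by
    have := hβ 0
    simp only [TernTree.mass_zero, TernTree.avoidBound_leaf, TernTree.totalMass_zero] at this
    norm_num at this
    linarith
  -- The threshold satisfies `(t ^ δ) ^ (r + 4) = t ^ (r + 3)`, two powers of `t` above the moment
  -- bound, so the tail is summable.
  refine ⟨(r + 3) / (r + 4), by rw [div_lt_one (by positivity)]; linarith,
    3 ^ (r + 4) * β * 3 ^ (r + 1), ?_⟩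
  intro Ω _ μ _ R hR t ht
  have ht0 : (1 : ℝ) ≤ t := by exact_mod_cast ht
  have htpos : (0 : ℝ) < t := by linarith
  have hδ : ((t : ℝ) ^ (((r : ℝ) + 3) / (r + 4))) ^ (r + 4) = (t : ℝ) ^ (r + 3) := by
    rw [← Real.rpow_natCast, ← Real.rpow_mul htpos.le, ← Real.rpow_natCast]
    congr 1
    push_cast
    field_simp
  set f : Apollonian → ENNReal := fun G =>
    ENNReal.ofReal ((longestPathOrder G.graph : ℝ) ^ (r + 4) / (t : ℝ) ^ (r + 3))
  have hfm : Measurable f := fun _ _ => MeasurableSet.of_discrete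
  have h1 : μ {ω | (t : ℝ) ^ (((r : ℝ) + 3) / (r + 4)) ≤ longestPathOrder (R t ω).graph} ≤
      ∫⁻ ω, f (R t ω) ∂μ := by
    -- Markov's inequality for the moment of order `r + 4`.
    refine meas_le_lintegral₀ (hfm.comp (hR.measurable t)).aemeasurable fun ω hω => ?_
    change 1 ≤ ENNReal.ofReal _
    rw [ENNReal.one_le_ofReal, one_le_div (by positivity), ← hδ]
    exact pow_le_pow_left₀ (by positivity) hω _
  have h2 := hR.lintegral_le_mass_div_totalMass t (f := f)
    (g := fun T => 3 ^ (r + 4) / (t : ℝ) ^ (r + 3) * (T.avoidBound : ℝ) ^ (r + 4))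
    (fun T => by positivity) fun T G hT _ => by
      refine ENNReal.ofReal_le_ofReal ?_
      rw [div_mul_eq_mul_div, ← mul_pow]
      gcongr
      exact_mod_cast hT.longestPathOrder_le
  refine h1.trans (h2.trans (ENNReal.ofReal_le_ofReal ?_))
  have p := TernTree.totalMass_pos t
  rw [TernTree.mass_const_mul, div_le_iff₀ p]
  calc _ ≤ 3 ^ (r + 4) / (t : ℝ) ^ (r + 3) *
        (β * (2 * t + 1) ^ (r + 1) * TernTree.totalMass t) := by
        gcongr
        exact hβ t
    _ ≤ 3 ^ (r + 4) / (t : ℝ) ^ (r + 3) * (β * (3 * t) ^ (r + 1) * TernTree.totalMass t) := by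
        gcongr
        linarith
    _ = _ := by
        rw [mul_pow]
        field_simp
        ring

theorem theorem2 :
    ∃ δ : ℝ, δ < 1 ∧
      ∀ {Ω : Type*} [MeasurableSpace Ω] (μ : Measure Ω) [IsProbabilityMeasure μ]
        (R : ℕ → Ω → Apollonian), IsRandomApollonianNetwork μ R →
        (∀ᵐ ω ∂μ, ∀ᶠ t : ℕ in atTop,
          (longestPathOrder (R t ω).graph : ℝ) < (t : ℝ) ^ δ) ∧
        Tendsto (fun t : ℕ => μ {ω | (longestPathOrder (R t ω).graph : ℝ) ≤ (t : ℝ) ^ δ})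
          atTop (𝓝 1) := by
  obtain ⟨δ, hδ, C, hC⟩ := IsRandomApollonianNetwork.exists_measure_le_longestPathOrder_le
  refine ⟨δ, hδ, ?_⟩
  intro Ω _ μ _ R hR
  -- The clause `0 < t` removes `t = 0`, where the bound is `0` because `1 / 0 = 0`.
  set s : ℕ → Set Ω := fun t => {ω | 0 < t ∧ (t : ℝ) ^ δ ≤ longestPathOrder (R t ω).graph} with hs
  have hsC : ∀ t, μ (s t) ≤ ENNReal.ofReal (C * (1 / (t : ℝ) ^ 2)) := by
    intro t
    rcases Nat.eq_zero_or_pos t with rfl | ht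
    · simp [hs]
    · simpa [hs, ht] using hC μ R hR t ht
  have hsum : ∑' t, μ (s t) ≠ ⊤ := by
    refine ne_top_of_le_ne_top ?_ (ENNReal.tsum_le_tsum hsC)
    exact ((Real.summable_one_div_nat_pow.2 one_lt_two).mul_left C).tsum_ofReal_ne_top
  refine ⟨?_, ?_⟩
  · filter_upwards [ae_eventually_notMem hsum] with ω hω
    filter_upwards [hω, eventually_gt_atTop 0] with t h1 h2
    by_contra h3
    exact h1 ⟨h2, not_lt.1 h3⟩
  · have h0 : Tendsto (fun t => 1 - μ (s t)) atTop (𝓝 1) := by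
      simpa using ENNReal.Tendsto.sub (tendsto_const_nhds (x := (1 : ENNReal)))
        (ENNReal.tendsto_atTop_zero_of_tsum_ne_top hsum) (.inl ENNReal.one_ne_top)
    refine tendsto_of_tendsto_of_tendsto_of_le_of_le' h0 tendsto_const_nhds ?_
      (Eventually.of_forall fun t => prob_le_one)
    filter_upwards [eventually_gt_atTop 0] with t ht
    rw [tsub_le_iff_right]
    refine le_trans ?_ (measure_union_le _ _)
    rw [← measure_univ (μ := μ)]
    refine measure_mono fun ω _ => ?_
    rcases le_total (longestPathOrder (R t ω).graph : ℝ) ((t : ℝ) ^ δ) with h | h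
    · exact .inl h
    · exact .inr ⟨ht, h⟩
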